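/- **Model.** Let $M,d\ge 1$ and let $O_1,O_2,\dots$ be independent subjects. The $j$-th subject has a non-observed component number $\kappa_j\in\{1,\dots,M\}$ with known probabilities $p_j^m=P\{\kappa_j=m\}$, a regressor vector $\mathbf X_j=(X_j^1,\dots,X_j^d)^T\in\mathbb R^d$, an error $\varepsilon_j$ and a response $$Y_j=\sum_{i=1}^d b_i^{\kappa_j}X_j^i+\varepsilon_j ,$$ where $\mathbf b^m=(b^m_1,\dots,b^m_d)^T$, $m=1,\dots,M$, are unknown. Given $\kappa_j=m$, the vector $\mathbf X_j$ and the error $\varepsilon_j$ are independent, with distributions $F_{\mathbf X,m}$ and $F_{\varepsilon,m}$ that do not depend on $j$. Write $E_m$ for the expectation given that the component is $m$, and $\mathbf X=(X^1,\dots,X^d)^T$, $\varepsilon$ for the regressors and the error of a subject of this component. Assume $E_m\varepsilon=0$ and put $\sigma_m^2=E_m\varepsilon^2$, $D^{is(m)}=E_m[X^iX^s]$, $\mathbf D^{(m)}=(D^{is(m)})_{i,s}$, $\mathbf L^{is(m)}=(E_m[X^iX^sX^lX^q])_{l,q}$ and $\mathbf M^{is(m,r)}=(D^{il(m)}D^{sq(r)})_{l,q}$.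 **Estimator.** Let $\Gamma_n=\bigl(\frac1n\sum_{j=1}^n p_j^lp_j^i\bigr)_{l,i=1}^M$ with minors $\gamma_{mk;n}$, and let $$a_{j;n}^k=\frac1{\det\Gamma_n}\sum_{m=1}^M(-1)^{k+m}\gamma_{mk;n}\,p_j^m,\qquad \hat{\mathbf b}(k,n)=(\mathbb X^TA\mathbb X)^{-1}\mathbb X^TA\mathbb Y,$$ where $\mathbb X=(X_j^i)_{j\le n,\,i\le d}$, $\mathbb Y=(Y_1,\dots,Y_n)^T$, $A=\mathrm{diag}(a_{1;n}^k,\dots,a_{n;n}^k)$. **Dispersion matrix.** Fix $k\in\{1,\dots,M\}$. Let $\hat\alpha_{s,q;n}=\frac1n\sum_{j=1}^n(a_{j;n}^k)^2p_j^sp_j^q$, $\alpha_{s,q}=\lim_{n\to\infty}\hat\alpha_{s,q;n}$, $\alpha_s=\sum_{q=1}^M\alpha_{s,q}$. Put $\mathbf V=(\mathbf D^{(k)})^{-1}\Sigma(\mathbf D^{(k)})^{-1}$, where $\Sigma=(\Sigma^{il})_{i,l=1}^d$, $$\Sigma^{il}=\sum_{s=1}^M\alpha_s\bigl(D^{il(s)}\sigma_s^2+(\mathbf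 b^s-\mathbf b^k)^T\mathbf L^{il(s)}(\mathbf b^s-\mathbf b^k)\bigr)-\sum_{s,m=1}^M\alpha_{s,m}(\mathbf b^s-\mathbf b^k)^T\mathbf M^{il(s,m)}(\mathbf b^m-\mathbf b^k).$$ Let $\hat{\mathbf V}_n$ be obtained from $\mathbf V$ by replacing, for all $i,l,s,q,m$, $D^{is(m)}$ by $\frac1n\sum_{j\le n} a_{j;n}^mX_j^iX_j^s$, $\mathbf L^{is(m)}$ by $\frac1n\sum_{j\le n} a_{j;n}^mX_j^iX_j^s\mathbf X_j\mathbf X_j^T$, $\mathbf b^m$ by $\hat{\mathbf b}(m,n)$, $\sigma_m^2$ by $\frac1n\sum_{j\le n} a_{j;n}^m(Y_j-\mathbf X_j^T\hat{\mathbf b}(m,n))^2$, and $\alpha_{s,q}$ by $\hat\alpha_{s,q;n}$. **Confidence set.** For $0<\alpha<1$ let $$B_\alpha^{LS}=\Bigl\{\beta\in\mathbb R^d:\ n(\beta-\hat{\mathbf b}(k,n))^T\hat{\mathbf V}_n^{-1}(\beta-\hat{\mathbf b}(k,n))\le Q^{\chi^2_d}(1-\alpha)\Bigr\},$$ where $Q^{\chi^2_d}(1-\alpha)$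 is the $(1-\alpha)$-quantile of the $\chi^2$ distribution with $d$ degrees of freedom. **Theorem.** Assume that 1. $E_m[(X^i)^4]<\infty$ and $E_m[\varepsilon^4]<\infty$ for all $m=1,\dots,M$, $i=1,\dots,d$; 2. the matrices $\mathbf D^{(m)}$, $m=1,\dots,M$, and $\mathbf V$ are nonsingular; 3. there exists $C>0$ such that $\det\Gamma_n>C$ for all $n$ large enough; 4. the limits $\alpha_{s,q}$ exist for all $s,q=1,\dots,M$. Then $$\lim_{n\to\infty}P\{\mathbf b^k\notin B_\alpha^{LS}\}=\alpha .$$ That is, $B^{LS}_\alpha$ is an asymptotic confidence set of significance level $\alpha$ for $\mathbf b^k$. -/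

import Mathlib

open MeasureTheory ProbabilityTheory Filter Topology Matrix

noncomputable section

namespace MixReg

/-! ### The mixture model -/

/-- Observations `(Y j, X j)`, `j = 0, 1, 2, …`, of independent subjects from a mixture with varying
concentrations of linear regressions. `κ j` is the (unobserved) component of the `j`-th subject,
`p j m` is the probability that it equals `m`, `b m` is the vector of regression coefficients of the
`m`-th component, `FX m` and `Fe m` are the distributions of the regressors and of the error within
the `m`-th component. The condition `p j m ≠ 0` is there because otherwise the conditional law given
`κ j = m` is not defined. -/
structure IsRegressionMixture {Ω : Type*} [MeasurableSpace Ω] (μ : Measure Ω) {M d : ℕ}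
    (p : ℕ → Fin M → ℝ) (b : Fin M → Fin d → ℝ)
    (FX : Fin M → Measure (Fin d → ℝ)) (Fe : Fin M → Measure ℝ)
    (κ : ℕ → Ω → Fin M) (X : ℕ → Ω → Fin d → ℝ) (ε : ℕ → Ω → ℝ) (Y : ℕ → Ω → ℝ) : Prop where
  measurable_component : ∀ j, Measurable (κ j)
  measurable_regressors : ∀ j, Measurable (X j)
  measurable_error : ∀ j, Measurable (ε j)
  /-- the subjects are independent -/
  indep_subjects : iIndepFun (fun j ω => (κ j ω, X j ω, ε j ω)) μ
  /-- the mixing probabilities -/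
  prob_component : ∀ j m, μ.real (κ j ⁻¹' {m}) = p j m
  /-- the conditional law of the regressors given the component -/
  law_regressors : ∀ j m, p j m ≠ 0 → (μ[|κ j ⁻¹' {m}]).map (X j) = FX m
  /-- the conditional law of the error given the component -/
  law_error : ∀ j m, p j m ≠ 0 → (μ[|κ j ⁻¹' {m}]).map (ε j) = Fe m
  /-- regressors and error are conditionally independent given the component -/
  condIndep : ∀ j m, p j m ≠ 0 → IndepFun (X j) (ε j) (μ[|κ j ⁻¹' {m}])
  /-- the errors have zero mean within each component -/
  error_mean : ∀ m, ∫ e, e ∂(Fe m) = 0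
  /-- the regression equation -/
  response : ∀ j ω, Y j ω = b (κ j ω) ⬝ᵥ X j ω + ε j ω

/-- The matrix of second moments, `D i s = E [X^i X^s]`. -/
def secondMoment {d : ℕ} (F : Measure (Fin d → ℝ)) : Matrix (Fin d) (Fin d) ℝ :=
  Matrix.of fun i s => ∫ x, x i * x s ∂F

/-- The matrices `L i s = (E [X^i X^s X^l X^q])_{l,q}` of fourth moments. -/
def fourthMoment {d : ℕ} (F : Measure (Fin d → ℝ)) (i s : Fin d) : Matrix (Fin d) (Fin d) ℝ :=
  Matrix.of fun l q => ∫ x, x i * x s * x l * x q ∂F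

/-! ### Minimax weights and the weighted least squares estimator

Below `p` are the (known) mixing probabilities, `x : ℕ → Fin d → ℝ` and `y : ℕ → ℝ` are realisations
of the regressors and of the response; only the first `n` observations are used. -/

/-- The Gram matrix `Γ_n` of the mixing probabilities. -/
def gramMatrix {M : ℕ} (p : ℕ → Fin M → ℝ) (n : ℕ) : Matrix (Fin M) (Fin M) ℝ :=
  Matrix.of fun l i => (1 / (n : ℝ)) * ∑ j ∈ Finset.range n, p j l * p j i

/-- The minimax weight `a_{j;n}^k = (det Γ_n)⁻¹ ∑ m, (-1)^(k+m) γ_{mk;n} p_j^m`, where `γ_{mk;n}` is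
the `(m,k)`-th minor of `Γ_n`; the entry `(k,m)` of the adjugate is `(-1)^(k+m) γ_{mk;n}`. -/
def weight {M : ℕ} (p : ℕ → Fin M → ℝ) (k : Fin M) (n j : ℕ) : ℝ :=
  (1 / (gramMatrix p n).det) * ∑ m, (gramMatrix p n).adjugate k m * p j m

/-- The weighted least squares estimator `(Xᵀ A X)⁻¹ Xᵀ A Y` for the `k`-th component, where `A` is
the diagonal matrix of the weights for the `k`-th component. -/
def lsEstimator {M d : ℕ} (p : ℕ → Fin M → ℝ) (x : ℕ → Fin d → ℝ) (y : ℕ → ℝ)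
    (k : Fin M) (n : ℕ) : Fin d → ℝ :=
  let XX : Matrix (Fin n) (Fin d) ℝ := Matrix.of fun j i => x j i
  let A : Matrix (Fin n) (Fin n) ℝ := Matrix.diagonal fun j => weight p k n j
  let YY : Fin n → ℝ := fun j => y j
  (XXᵀ * A * XX)⁻¹ *ᵥ ((XXᵀ * A) *ᵥ YY)

/-! ### The dispersion matrix and its estimator -/

/-- The matrix `Σ` as a function of `α_{s,q}`, of the second and fourth moments `D`, `L` of the
regressors, of the coefficients `b` and of the error variances `σ2` of the components. The matrix
`M^{il(s,m)}` of the last sum has entries `D^{iq(s)} D^{lr(m)}`, and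
`α_s = ∑ q, α_{s,q}`. -/
def sigmaMatrix {M d : ℕ} (k : Fin M) (α : Fin M → Fin M → ℝ)
    (D : Fin M → Matrix (Fin d) (Fin d) ℝ)
    (L : Fin M → Fin d → Fin d → Matrix (Fin d) (Fin d) ℝ)
    (b : Fin M → Fin d → ℝ) (σ2 : Fin M → ℝ) : Matrix (Fin d) (Fin d) ℝ :=
  Matrix.of fun i l =>
    (∑ s, (∑ q, α s q) *
      (D s i l * σ2 s + (b s - b k) ⬝ᵥ (L s i l *ᵥ (b s - b k))))
    - ∑ s, ∑ m, α s m *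
      ((b s - b k) ⬝ᵥ ((Matrix.of fun q r => D s i q * D m l r) *ᵥ (b m - b k)))

/-- The matrix `V = D⁻¹ Σ D⁻¹`, with `D` the second moment matrix of the `k`-th component. -/
def dispersion {M d : ℕ} (k : Fin M) (α : Fin M → Fin M → ℝ)
    (D : Fin M → Matrix (Fin d) (Fin d) ℝ)
    (L : Fin M → Fin d → Fin d → Matrix (Fin d) (Fin d) ℝ)
    (b : Fin M → Fin d → ℝ) (σ2 : Fin M → ℝ) : Matrix (Fin d) (Fin d) ℝ :=
  (D k)⁻¹ * sigmaMatrix k α D L b σ2 * (D k)⁻¹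

/-- `(1/n) ∑ j, (a_{j;n}^k)² p_j^s p_j^q`, whose limit is `α_{s,q}^{(k)}`. -/
def alphaHat {M : ℕ} (p : ℕ → Fin M → ℝ) (k : Fin M) (n : ℕ) (s q : Fin M) : ℝ :=
  (1 / (n : ℝ)) * ∑ j ∈ Finset.range n, weight p k n j ^ 2 * p j s * p j q

/-- The estimator of the second moments of the regressors of the `m`-th component. -/
def secondMomentHat {M d : ℕ} (p : ℕ → Fin M → ℝ) (x : ℕ → Fin d → ℝ) (n : ℕ) (m : Fin M) :
    Matrix (Fin d) (Fin d) ℝ :=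
  Matrix.of fun i s => (1 / (n : ℝ)) * ∑ j ∈ Finset.range n, weight p m n j * x j i * x j s

/-- The estimator of the fourth moments of the regressors of the `m`-th component. -/
def fourthMomentHat {M d : ℕ} (p : ℕ → Fin M → ℝ) (x : ℕ → Fin d → ℝ) (n : ℕ) (m : Fin M)
    (i s : Fin d) : Matrix (Fin d) (Fin d) ℝ :=
  Matrix.of fun l q =>
    (1 / (n : ℝ)) * ∑ j ∈ Finset.range n, weight p m n j * x j i * x j s * (x j l * x j q)

/-- The estimator of the error variance of the `m`-th component. -/
def errorVarHat {M d : ℕ} (p : ℕ → Fin M → ℝ) (x : ℕ → Fin d → ℝ) (y : ℕ → ℝ) (n : ℕ)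
    (m : Fin M) : ℝ :=
  (1 / (n : ℝ)) * ∑ j ∈ Finset.range n, weight p m n j * (y j - x j ⬝ᵥ lsEstimator p x y m n) ^ 2

/-- The plug-in estimator `V̂_n` of the dispersion matrix. -/
def dispersionHat {M d : ℕ} (p : ℕ → Fin M → ℝ) (x : ℕ → Fin d → ℝ) (y : ℕ → ℝ)
    (k : Fin M) (n : ℕ) : Matrix (Fin d) (Fin d) ℝ :=
  dispersion k (alphaHat p k n) (secondMomentHat p x n) (fourthMomentHat p x n)
    (fun m => lsEstimator p x y m n) (errorVarHat p x y n)

/-! ### The confidence set -/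

/-- The `χ²` distribution with `d` degrees of freedom: the law of the sum of squares of `d`
independent standard normal variables. -/
def chiSq (d : ℕ) : Measure ℝ :=
  (Measure.pi fun _ : Fin d => gaussianReal 0 1).map fun z => ∑ i, z i ^ 2

/-- The `u`-quantile of a probability distribution on the line, `0 < u < 1`. -/
def quantile (ν : Measure ℝ) (u : ℝ) : ℝ := sInf {t | u ≤ ν.real (Set.Iic t)}

/-- `S(β) = n (β - b̂)ᵀ V̂_n⁻¹ (β - b̂)`. -/
def statS {M d : ℕ} (p : ℕ → Fin M → ℝ) (x : ℕ → Fin d → ℝ) (y : ℕ → ℝ)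
    (k : Fin M) (n : ℕ) (β : Fin d → ℝ) : ℝ :=
  n * ((β - lsEstimator p x y k n) ⬝ᵥ
    ((dispersionHat p x y k n)⁻¹ *ᵥ (β - lsEstimator p x y k n)))

/-- The nonparametric confidence set `B_α` for the coefficients of the `k`-th component. -/
def confidenceSet {M d : ℕ} (p : ℕ → Fin M → ℝ) (x : ℕ → Fin d → ℝ) (y : ℕ → ℝ)
    (k : Fin M) (n : ℕ) (α : ℝ) : Set (Fin d → ℝ) :=
  {β | statS p x y k n β ≤ quantile (chiSq d) (1 - α)}

end MixReg

end

open MixReg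

namespace MixReg

/-! ### A central limit theorem for triangular arrays -/

/-! The weights are biorthogonal to the mixing probabilities: the average of a_j^k p_j^m over j ≤ n
is 1 for m = k and 0 otherwise (`average_weight_mul_prob`). A weighted average over the mixed sample
therefore has exactly the mean of the k-th component, although the concentrations p_j need not
converge. They are also eventually bounded (`exists_abs_weight_le`), because det Γ_n stays away from
zero.

Write D̂ for the weighted second moment matrix and u for n^(-1/2) Σ_j a_j^k X_j (Y_j - X_jᵀ b^k),
the normalized sum of the scores. When D̂ is invertible, √n (b̂ - b^k) = D̂⁻¹ u, so the statistic at
the true coefficients is uᵀ (D̂⁻¹ V̂⁻¹ D̂⁻¹) u (`statS_eq`). Two limits remain.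

The vector u is asymptotically N(0, Σ) (`tendstoInDistribution_scoreSum`). A single score need not
be centered, but the weighted sum is, because the score at b^k has mean zero within component k. The
variance of tᵀu is exactly tᵀΣt with `alphaHat` in place of its limit
(`average_sq_weight_mul_variance`), so convergence of `alphaHat` is all that is needed. The subjects
are not identically distributed, but all their laws lie below one finite measure, the sum of the
component laws. Integrability under that measure replaces both the Lindeberg condition in the
central limit theorem and identical distribution in the law of large numbers.

The law of large numbers gives D̂ → D and V̂ → V in probability, hence D̂⁻¹ V̂⁻¹ D̂⁻¹ → D⁻¹ V⁻¹ D⁻¹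
= Σ⁻¹. By Slutsky's theorem the statistic converges to ZᵀΣ⁻¹Z with Z normal of covariance Σ, which
has the χ² law (`map_quadraticForm_multivariateGaussian`). This law has no atoms for d ≥ 1, so the
tail probability beyond its quantile converges to α; the event that D̂ is singular has vanishing
probability. -/

lemma norm_cexp_mul_I_sub_taylor_le (x : ℝ) :
    ‖Complex.exp (x * Complex.I) - (1 + x * Complex.I - (x : ℂ) ^ 2 / 2)‖
      ≤ 4 * min (x ^ 2) (|x| ^ 3) := by
  have hnx : ‖(x : ℂ) * Complex.I‖ = |x| := by simp
  -- The cubic Taylor remainder is the smaller bound up to 1; beyond 1 all terms are estimated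
  -- separately and absorbed into x².
  rcases le_or_gt |x| 1 with hx | hx
  · have h := Complex.exp_bound (x := x * Complex.I) (hnx.trans_le hx) (n := 3) (by norm_num)
    have hs : ∑ m ∈ Finset.range 3, ((x : ℂ) * Complex.I) ^ m / (m.factorial : ℂ)
        = 1 + x * Complex.I - (x : ℂ) ^ 2 / 2 := by
      simp only [Finset.sum_range_succ, Finset.range_zero, Finset.sum_empty, mul_pow,
        Complex.I_sq]
      norm_num [Nat.factorial]
      ring
    rw [hs, hnx] at h
    have h3 : |x| ^ 3 ≤ x ^ 2 := by
      rw [← sq_abs x]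
      exact pow_le_pow_of_le_one (abs_nonneg x) hx (by norm_num)
    rw [min_eq_right h3]
    refine h.trans ?_
    rw [mul_comm 4]
    gcongr
    norm_num [Nat.factorial]
  · have h3 : x ^ 2 ≤ |x| ^ 3 := by
      rw [← sq_abs x]
      exact pow_le_pow_right₀ hx.le (by norm_num)
    rw [min_eq_left h3]
    have hsq : ‖(x : ℂ) ^ 2 / 2‖ = x ^ 2 / 2 := by
      simp [norm_pow, sq_abs]
    calc ‖Complex.exp (x * Complex.I) - (1 + x * Complex.I - (x : ℂ) ^ 2 / 2)‖
        ≤ ‖Complex.exp (x * Complex.I)‖ + (‖(1 : ℂ) + x * Complex.I‖ + ‖(x : ℂ) ^ 2 / 2‖) :=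
          (norm_sub_le _ _).trans (by gcongr; exact norm_sub_le _ _)
      _ ≤ 1 + ((1 + |x|) + x ^ 2 / 2) := by
          rw [Complex.norm_exp_ofReal_mul_I, hsq]
          gcongr
          refine (norm_add_le _ _).trans ?_
          rw [hnx, norm_one]
      _ ≤ 4 * x ^ 2 := by nlinarith [sq_abs x]

/-- Exchange the factors one at a time; those left untouched have norm at most one and cost nothing.
-/
lemma norm_finsetProd_sub_finsetProd_le {ι : Type*} (s : Finset ι) (z w : ι → ℂ)
    (hz : ∀ i ∈ s, ‖z i‖ ≤ 1) (hw : ∀ i ∈ s, ‖w i‖ ≤ 1) :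
    ‖∏ i ∈ s, z i - ∏ i ∈ s, w i‖ ≤ ∑ i ∈ s, ‖z i - w i‖ := by
  classical
  induction s using Finset.induction_on with
  | empty => simp
  | insert a s ha ih =>
    rw [Finset.prod_insert ha, Finset.prod_insert ha, Finset.sum_insert ha]
    have hs := ih (fun i hi => hz i (Finset.mem_insert_of_mem hi))
      (fun i hi => hw i (Finset.mem_insert_of_mem hi))
    have hzs : ‖∏ i ∈ s, z i‖ ≤ 1 := by
      rw [norm_prod]
      exact Finset.prod_le_one (fun _ _ => norm_nonneg _)
        (fun i hi => hz i (Finset.mem_insert_of_mem hi))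
    have hwa := hw a (Finset.mem_insert_self a s)
    calc ‖z a * ∏ i ∈ s, z i - w a * ∏ i ∈ s, w i‖
        = ‖(z a - w a) * ∏ i ∈ s, z i + w a * (∏ i ∈ s, z i - ∏ i ∈ s, w i)‖ := by ring_nf
      _ ≤ ‖z a - w a‖ * ‖∏ i ∈ s, z i‖ + ‖w a‖ * ‖∏ i ∈ s, z i - ∏ i ∈ s, w i‖ := by
          refine (norm_add_le _ _).trans ?_
          rw [norm_mul, norm_mul]
      _ ≤ ‖z a - w a‖ * 1 + 1 * ∑ i ∈ s, ‖z i - w i‖ := by gcongr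
      _ = _ := by ring

lemma abs_exp_neg_sub_one_add_le {x : ℝ} (hx : 0 ≤ x) : |Real.exp (-x) - 1 + x| ≤ x ^ 2 := by
  rcases le_or_gt x 1 with h | h
  · have := Real.norm_exp_sub_one_sub_id_le (x := -x) (by simpa [abs_of_nonneg hx] using h)
    simpa [sub_neg_eq_add] using this
  · have h1 : Real.exp (-x) ≤ 1 := Real.exp_le_one_iff.2 (by linarith)
    have h2 := Real.add_one_le_exp (-x)
    rw [abs_le]
    constructor <;> nlinarith

section CharacteristicFunctions

variable {Ω : Type*} [MeasurableSpace Ω] {μ : Measure Ω}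

lemma integrable_min_sq_cube {Y : Ω → ℝ} (hY : MemLp Y 2 μ) :
    Integrable (fun ω => min (Y ω ^ 2) (|Y ω| ^ 3)) μ := by
  have hm := hY.aestronglyMeasurable.aemeasurable
  refine hY.integrable_sq.mono' (by fun_prop) (.of_forall fun ω => ?_)
  rw [Real.norm_of_nonneg (by positivity)]
  exact min_le_left _ _

/-- Integrating the Taylor bound, the linear term drops out by centering. The minimum is kept
because only second moments are available, so the cube alone may fail to be integrable. -/
lemma norm_integral_cexp_sub_le [IsProbabilityMeasure μ] {Y : Ω → ℝ} (hY : MemLp Y 2 μ) (h0 : ∫ ω, Y ω ∂μ = 0) :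
    ‖∫ ω, Complex.exp (Y ω * Complex.I) ∂μ - (1 - (∫ ω, Y ω ^ 2 ∂μ : ℝ) / 2)‖
      ≤ 4 * ∫ ω, min (Y ω ^ 2) (|Y ω| ^ 3) ∂μ := by
  have hm := hY.aestronglyMeasurable.aemeasurable
  have hint1 : Integrable (fun ω => Complex.exp (Y ω * Complex.I)) μ := by
    refine Integrable.of_bound (C := 1) (by fun_prop) (.of_forall fun ω => ?_)
    rw [Complex.norm_exp_ofReal_mul_I]
  have hYi : Integrable (fun ω => (Y ω : ℂ) * Complex.I) μ :=
    ((hY.integrable (by norm_num)).ofReal).mul_const _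
  have hY2 : Integrable (fun ω => ((Y ω ^ 2 : ℝ) : ℂ) / 2) μ :=
    (hY.integrable_sq.ofReal).div_const _
  have heq : ∫ ω, Complex.exp (Y ω * Complex.I) ∂μ - (1 - (∫ ω, Y ω ^ 2 ∂μ : ℝ) / 2)
      = ∫ ω, (Complex.exp (Y ω * Complex.I) - (1 + Y ω * Complex.I - (Y ω : ℂ) ^ 2 / 2)) ∂μ := by
    have h1 : Integrable (fun ω => (1 : ℂ) + Y ω * Complex.I) μ := (integrable_const _).add hYi
    have h2 : Integrable (fun ω => (Y ω : ℂ) ^ 2 / 2) μ := by simpa using hY2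
    have h3 : Integrable (fun ω => (1 : ℂ) + Y ω * Complex.I - (Y ω : ℂ) ^ 2 / 2) μ := h1.sub h2
    rw [integral_sub hint1 h3, integral_sub h1 h2, integral_add (integrable_const _) hYi,
      integral_mul_const, integral_complex_ofReal, h0, integral_div]
    simp only [← Complex.ofReal_pow]
    rw [integral_complex_ofReal]
    simp
  rw [heq, ← integral_const_mul]
  exact norm_integral_le_of_norm_le ((integrable_min_sq_cube hY).const_mul 4)
    (.of_forall fun ω => norm_cexp_mul_I_sub_taylor_le _)

lemma integral_cexp_sum_eq_prod {Y : ℕ → Ω → ℝ} (hindep : iIndepFun Y μ)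
    (hmeas : ∀ j, AEMeasurable (Y j) μ) (n : ℕ) :
    ∫ ω, Complex.exp ((∑ j ∈ Finset.range n, Y j ω : ℝ) * Complex.I) ∂μ
      = ∏ j ∈ Finset.range n, ∫ ω, Complex.exp (Y j ω * Complex.I) ∂μ := by
  have h := congrFun ((hindep.restrict (Finset.range n)).charFun_map_fun_finsetSum_eq_prod
    (fun j _ => hmeas j)) 1
  rw [charFun_apply_real, integral_map (by fun_prop) (by fun_prop)] at h
  simp only [Complex.ofReal_one, one_mul] at h
  rw [h, Finset.prod_apply]
  refine Finset.prod_congr rfl fun j _ => ?_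
  rw [charFun_apply_real, integral_map (hmeas j) (by fun_prop)]
  simp

/-- The characteristic function form of the central limit theorem for the row sums of a triangular
array of centered independent variables. -/
theorem tendsto_integral_cexp_sum [IsProbabilityMeasure μ] {Y : ℕ → ℕ → Ω → ℝ} (hindep : ∀ n, iIndepFun (Y n) μ)
    (hL2 : ∀ n j, MemLp (Y n j) 2 μ) (hmean : ∀ n j, ∫ ω, Y n j ω ∂μ = 0) {v : ℝ}
    (hvar : Tendsto (fun n => ∑ j ∈ Finset.range n, ∫ ω, Y n j ω ^ 2 ∂μ) atTop (𝓝 v))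
    (hsq : Tendsto (fun n => ∑ j ∈ Finset.range n, (∫ ω, Y n j ω ^ 2 ∂μ) ^ 2) atTop (𝓝 0))
    (hrem : Tendsto (fun n => ∑ j ∈ Finset.range n, ∫ ω, min (Y n j ω ^ 2) (|Y n j ω| ^ 3) ∂μ)
      atTop (𝓝 0)) :
    Tendsto (fun n => ∫ ω, Complex.exp ((∑ j ∈ Finset.range n, Y n j ω : ℝ) * Complex.I) ∂μ)
      atTop (𝓝 (Complex.exp (-(v : ℂ) / 2))) := by
  set s : ℕ → ℕ → ℝ := fun n j => ∫ ω, Y n j ω ^ 2 ∂μ with hs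
  have hs0 : ∀ n j, 0 ≤ s n j := fun n j => integral_nonneg fun ω => sq_nonneg _
  -- The comparison product is the characteristic function at 1 of a sum of independent normal
  -- variables with the same variances; it depends on their sum only.
  have hlim : Tendsto (fun n => ∏ j ∈ Finset.range n, ((Real.exp (-(s n j / 2)) : ℝ) : ℂ)) atTop
      (𝓝 (Complex.exp (-(v : ℂ) / 2))) := by
    have : ∀ n, ∏ j ∈ Finset.range n, ((Real.exp (-(s n j / 2)) : ℝ) : ℂ)
        = ((Real.exp (-(∑ j ∈ Finset.range n, s n j) / 2) : ℝ) : ℂ) := by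
      intro n
      rw [← Complex.ofReal_prod, ← Real.exp_sum, neg_div, Finset.sum_div, Finset.sum_neg_distrib]
    simp_rw [this]
    have h2 : Complex.exp (-(v : ℂ) / 2) = ((Real.exp (-v / 2) : ℝ) : ℂ) := by push_cast; rfl
    rw [h2]
    exact (Complex.continuous_ofReal.tendsto _).comp
      ((Real.continuous_exp.tendsto _).comp (hvar.neg.div_const 2))
  refine (tendsto_iff_of_dist ?_).1 hlim
  have hbound : Tendsto (fun n => 4 * (∑ j ∈ Finset.range n, ∫ ω, min (Y n j ω ^ 2)
      (|Y n j ω| ^ 3) ∂μ) + ∑ j ∈ Finset.range n, (s n j) ^ 2) atTop (𝓝 0) := by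
    simpa using (hrem.const_mul 4).add hsq
  refine squeeze_zero (fun n => dist_nonneg) (fun n => ?_) hbound
  rw [dist_comm, dist_eq_norm, integral_cexp_sum_eq_prod (hindep n)
    (fun j => (hL2 n j).aestronglyMeasurable.aemeasurable), Finset.mul_sum,
    ← Finset.sum_add_distrib]
  refine (norm_finsetProd_sub_finsetProd_le _ _ _ (fun j _ => ?_) (fun j _ => ?_)).trans
    (Finset.sum_le_sum fun j _ => ?_)
  · refine (norm_integral_le_integral_norm _).trans ?_
    simp [Complex.norm_exp_ofReal_mul_I]
  · rw [Complex.norm_real, Real.norm_of_nonneg (Real.exp_pos _).le]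
    exact Real.exp_le_one_iff.2 (by have := hs0 n j; linarith)
  -- Both factors are compared with 1 - s/2. The Taylor remainder accounts for `hrem`, the
  -- second-order error of the exponential for `hsq`.
  · have h1 := norm_integral_cexp_sub_le (hL2 n j) (hmean n j)
    have h2 : ‖((1 : ℂ) - (s n j : ℝ) / 2) - ((Real.exp (-(s n j / 2)) : ℝ) : ℂ)‖
        ≤ s n j ^ 2 := by
      have h3 := abs_exp_neg_sub_one_add_le (x := s n j / 2) (by have := hs0 n j; linarith)
      have h4 : ((1 : ℂ) - (s n j : ℝ) / 2) - ((Real.exp (-(s n j / 2)) : ℝ) : ℂ)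
          = ((-(Real.exp (-(s n j / 2)) - 1 + s n j / 2) : ℝ) : ℂ) := by push_cast; ring
      rw [h4, Complex.norm_real, norm_neg, Real.norm_eq_abs]
      refine h3.trans ?_
      have := hs0 n j
      nlinarith
    calc _ ≤ _ := norm_sub_le_norm_sub_add_norm_sub _ ((1 : ℂ) - (s n j : ℝ) / 2) _
      _ ≤ _ := add_le_add h1 h2

end CharacteristicFunctions

/-! ### Weighted sums of independent variables with dominated laws -/

section Dominated

variable {Ω S : Type*} [MeasurableSpace Ω] [MeasurableSpace S] {μ : Measure Ω}
  {ν : Measure S} {O : ℕ → Ω → S}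

lemma memLp_comp_of_map_le {p : ENNReal} {f : S → ℝ} (hO : ∀ j, Measurable (O j))
    (hdom : ∀ j, μ.map (O j) ≤ ν) (hf : MemLp f p ν) (j : ℕ) :
    MemLp (fun ω => f (O j ω)) p μ :=
  (hf.mono_measure (hdom j)).comp_of_map (hO j).aemeasurable

lemma integrable_comp_of_map_le {f : S → ℝ} (hO : ∀ j, Measurable (O j))
    (hdom : ∀ j, μ.map (O j) ≤ ν) (hf : Integrable f ν) (j : ℕ) :
    Integrable (fun ω => f (O j ω)) μ :=
  (hf.mono_measure (hdom j)).comp_measurable (hO j)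

lemma integral_comp_le_of_map_le {f : S → ℝ} (hO : ∀ j, Measurable (O j))
    (hdom : ∀ j, μ.map (O j) ≤ ν) (hf : Integrable f ν) (hf0 : ∀ x, 0 ≤ f x) (j : ℕ) :
    ∫ ω, f (O j ω) ∂μ ≤ ∫ x, f x ∂ν := by
  rw [← integral_map (hO j).aemeasurable (hf.mono_measure (hdom j)).aestronglyMeasurable]
  exact integral_mono_measure (hdom j) (.of_forall hf0) hf

/-- Dominated convergence with dominant H²: pointwise the cubic branch tends to zero. This plays the
role of the Lindeberg condition and uses no moment above the second. -/
lemma tendsto_integral_min_sq_cube_div_sqrt {H : S → ℝ} (hH : MemLp H 2 ν) (hH0 : ∀ x, 0 ≤ H x) :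
    Tendsto (fun n : ℕ => ∫ x, min (H x ^ 2) (H x ^ 3 / √n) ∂ν) atTop (𝓝 0) := by
  have hm := hH.aestronglyMeasurable.aemeasurable
  rw [← integral_zero S ℝ (μ := ν)]
  refine tendsto_integral_of_dominated_convergence (fun x => H x ^ 2) (fun n => by fun_prop)
    hH.integrable_sq (fun n => .of_forall fun x => ?_) (.of_forall fun x => ?_)
  · have := hH0 x
    rw [Real.norm_of_nonneg (by positivity)]
    exact min_le_left _ _
  · have hx := hH0 x
    refine squeeze_zero (fun n => by positivity) (fun n => min_le_right _ _) ?_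
    exact tendsto_const_nhds.div_atTop
      (Real.tendsto_sqrt_atTop.comp tendsto_natCast_atTop_atTop)

/-- Central limit theorem for weighted sums of independent variables with laws dominated by a
common finite measure. -/
theorem tendsto_integral_cexp_weighted_sum [IsProbabilityMeasure μ] [IsFiniteMeasure ν]
    (hO : ∀ j, Measurable (O j)) (hindep : iIndepFun O μ) (hdom : ∀ j, μ.map (O j) ≤ ν)
    {f : S → ℝ} (hfm : Measurable f) (hf : MemLp f 2 ν) {c : ℕ → ℕ → ℝ} {W : ℝ}
    (hc : ∀ᶠ n in atTop, ∀ j, |c n j| ≤ W) {v : ℝ}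
    (hv : Tendsto (fun n : ℕ => (1 / (n : ℝ)) *
      ∑ j ∈ Finset.range n, c n j ^ 2 * Var[fun ω => f (O j ω); μ]) atTop (𝓝 v)) :
    Tendsto (fun n : ℕ => ∫ ω, Complex.exp (((√n)⁻¹ *
      (∑ j ∈ Finset.range n, (c n j * f (O j ω) - c n j * ∫ ω, f (O j ω) ∂μ)) : ℝ) * Complex.I) ∂μ)
      atTop (𝓝 (Complex.exp (-(v : ℂ) / 2))) := by
  have hfO := memLp_comp_of_map_le hO hdom hf
  have hW0 : 0 ≤ W := by
    obtain ⟨n, hn⟩ := hc.exists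
    exact (abs_nonneg _).trans (hn 0)
  have hfint : Integrable f ν := hf.integrable (by norm_num)
  set Y : ℕ → ℕ → Ω → ℝ := fun n j ω =>
    (√n)⁻¹ * (c n j * (f (O j ω) - ∫ ω, f (O j ω) ∂μ)) with hY
  have hYsum : ∀ (n : ℕ) ω, (√n)⁻¹ *
      (∑ j ∈ Finset.range n, (c n j * f (O j ω) - c n j * ∫ ω, f (O j ω) ∂μ))
      = ∑ j ∈ Finset.range n, Y n j ω := by
    intro n ω
    rw [Finset.mul_sum]
    refine Finset.sum_congr rfl fun j _ => ?_
    simp only [hY]; ring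
  simp_rw [hYsum]
  have hsqn : ∀ n : ℕ, ((√n)⁻¹ : ℝ) ^ 2 = 1 / n := fun n => by
    rw [inv_pow, Real.sq_sqrt n.cast_nonneg, one_div]
  have hYsq : ∀ (n j : ℕ), ∫ ω, Y n j ω ^ 2 ∂μ
      = 1 / n * (c n j ^ 2 * Var[fun ω => f (O j ω); μ]) := by
    intro n j
    have hvar : Var[fun ω => f (O j ω); μ] = ∫ ω, (f (O j ω) - ∫ ω, f (O j ω) ∂μ) ^ 2 ∂μ :=
      variance_eq_integral (hfO j).aestronglyMeasurable.aemeasurable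
    rw [hvar, ← hsqn, ← integral_const_mul, ← integral_const_mul]
    refine integral_congr_ae (.of_forall fun ω => ?_)
    simp only [hY]; ring
  set C : ℝ := W ^ 2 * ∫ x, f x ^ 2 ∂ν
  have hvarle : ∀ j, Var[fun ω => f (O j ω); μ] ≤ ∫ x, f x ^ 2 ∂ν := fun j =>
    (variance_le_expectation_sq (hfO j).aestronglyMeasurable).trans
      (integral_comp_le_of_map_le hO hdom hf.integrable_sq (fun x => sq_nonneg _) j)
  have hcsq : ∀ n, (∀ j, |c n j| ≤ W) → ∀ j, c n j ^ 2 * Var[fun ω => f (O j ω); μ] ≤ C := by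
    intro n hn j
    exact mul_le_mul (sq_le_sq' (abs_le.1 (hn j)).1 (abs_le.1 (hn j)).2) (hvarle j)
      (variance_nonneg _ _) (by positivity)
  refine tendsto_integral_cexp_sum (fun n => ?_) (fun n j => ?_) (fun n j => ?_) ?_ ?_ ?_
  · exact hindep.comp (fun j x => (√n)⁻¹ * (c n j * (f x - ∫ ω, f (O j ω) ∂μ)))
      (fun j => by fun_prop)
  · exact (((hfO j).sub (memLp_const _)).const_mul _).const_mul _
  · rw [integral_const_mul, integral_const_mul,
      integral_sub ((hfO j).integrable (by norm_num)) (integrable_const _)]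
    simp
  · simp_rw [hYsq, ← Finset.mul_sum]
    exact hv
  -- Each of the n second moments is at most C/n, so their squares add up to at most C²/n.
  · refine squeeze_zero' (.of_forall fun n => Finset.sum_nonneg fun j _ => sq_nonneg _)
      (g := fun n : ℕ => C ^ 2 / n) ?_ (tendsto_const_div_atTop_nhds_zero_nat _)
    filter_upwards [hc, eventually_gt_atTop 0] with n hn hn0
    have hn0' : (0 : ℝ) < n := by exact_mod_cast hn0
    calc ∑ j ∈ Finset.range n, (∫ ω, Y n j ω ^ 2 ∂μ) ^ 2
        ≤ ∑ j ∈ Finset.range n, (1 / n * C) ^ 2 := by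
          refine Finset.sum_le_sum fun j _ => ?_
          rw [hYsq]
          have h1 := hcsq n hn j
          have h0 : 0 ≤ c n j ^ 2 * Var[fun ω => f (O j ω); μ] :=
            mul_nonneg (sq_nonneg _) (variance_nonneg _ _)
          gcongr
      _ = C ^ 2 / n := by
          rw [Finset.sum_const, Finset.card_range, nsmul_eq_mul]
          field_simp
  · set m : ℝ := ∫ x, |f x| ∂ν
    have hm0 : 0 ≤ m := integral_nonneg fun x => abs_nonneg _
    have hmean : ∀ j, |∫ ω, f (O j ω) ∂μ| ≤ m := fun j =>
      abs_integral_le_integral_abs.trans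
        (integral_comp_le_of_map_le hO hdom hfint.abs (fun x => abs_nonneg _) j)
    -- One function of the observation dominates every centered weighted summand, for all j and all
    -- large n: W bounds the weights and m all the means. After the scaling by 1/√n, the remainder
    -- of each summand is at most 1/n times the integral of min(H², H³/√n).
    set H : S → ℝ := fun x => W * (|f x| + m)
    have hH0 : ∀ x, 0 ≤ H x := fun x => by positivity
    have hH : MemLp H 2 ν := (hf.abs.add (memLp_const m)).const_mul W
    have hHm : Measurable H := by fun_prop
    refine squeeze_zero' (.of_forall fun n => Finset.sum_nonneg fun j _ =>
      integral_nonneg fun ω => by positivity) ?_ (tendsto_integral_min_sq_cube_div_sqrt hH hH0)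
    filter_upwards [hc, eventually_gt_atTop 0] with n hn hn0
    have hn0' : (0 : ℝ) < n := by exact_mod_cast hn0
    have hsn : 0 < √(n : ℝ) := Real.sqrt_pos.2 hn0'
    have hG : Integrable (fun x => min (H x ^ 2) (H x ^ 3 / √n)) ν := by
      refine hH.integrable_sq.mono' (by fun_prop) (.of_forall fun x => ?_)
      have := hH0 x
      rw [Real.norm_of_nonneg (by positivity)]
      exact min_le_left _ _
    have hG0 : ∀ x, 0 ≤ min (H x ^ 2) (H x ^ 3 / √n) := fun x => by
      have := hH0 x
      positivity
    calc ∑ j ∈ Finset.range n, ∫ ω, min (Y n j ω ^ 2) (|Y n j ω| ^ 3) ∂μ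
        ≤ ∑ j ∈ Finset.range n, 1 / n * ∫ x, min (H x ^ 2) (H x ^ 3 / √n) ∂ν := by
          refine Finset.sum_le_sum fun j _ => ?_
          refine le_trans ?_ (mul_le_mul_of_nonneg_left
            (integral_comp_le_of_map_le hO hdom hG hG0 j) (by positivity))
          rw [← integral_const_mul]
          refine integral_mono_of_nonneg (.of_forall fun ω => by positivity)
            ((integrable_comp_of_map_le hO hdom hG j).const_mul _) (.of_forall fun ω => ?_)
          have hYH : |Y n j ω| ≤ (√n)⁻¹ * H (O j ω) := by
            simp only [hY, abs_mul, abs_of_pos (inv_pos.2 hsn), H]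
            gcongr
            · exact hn j
            · exact (abs_sub _ _).trans (by gcongr; exact hmean j)
          have hHω := hH0 (O j ω)
          simp only
          rw [mul_min_of_nonneg _ _ (by positivity)]
          refine min_le_min ?_ ?_
          · rw [← sq_abs, ← hsqn, ← mul_pow]
            gcongr
          · calc |Y n j ω| ^ 3 ≤ ((√n)⁻¹ * H (O j ω)) ^ 3 := by gcongr
              _ = _ := by rw [← hsqn]; field_simp
      _ = ∫ x, min (H x ^ 2) (H x ^ 3 / √n) ∂ν := by
          rw [Finset.sum_const, Finset.card_range, nsmul_eq_mul]
          field_simp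

end Dominated

/-! ### Convergence in probability as convergence along a filter -/

section ProbFilter

variable {Ω : Type*} [MeasurableSpace Ω]

/-- The filter on `ℕ × Ω` of the events whose sections have (outer) probability tending to one.
Convergence of random variables to a constant along it is convergence in probability. -/
def probFilter (μ : Measure Ω) : Filter (ℕ × Ω) where
  sets := {A | Tendsto (fun n => μ {ω | (n, ω) ∉ A}) atTop (𝓝 0)}
  univ_sets := by simp
  sets_of_superset {A B} hA hAB :=
    tendsto_of_tendsto_of_tendsto_of_le_of_le tendsto_const_nhds hA (fun _ => zero_le)
      fun _ => measure_mono fun _ hω h => hω (hAB h)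
  inter_sets {A B} hA hB := by
    have h : Tendsto (fun n => μ {ω | (n, ω) ∉ A} + μ {ω | (n, ω) ∉ B}) atTop (𝓝 0) := by
      simpa using Tendsto.add hA hB
    refine tendsto_of_tendsto_of_tendsto_of_le_of_le tendsto_const_nhds h (fun _ => zero_le)
      fun n => (measure_mono fun ω hω => ?_).trans (measure_union_le _ _)
    by_contra hc
    simp only [Set.mem_union, Set.mem_ofPred_eq, not_or, not_not] at hc
    exact hω ⟨hc.1, hc.2⟩

variable {μ : Measure Ω}

lemma mem_probFilter_iff {A : Set (ℕ × Ω)} :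
    A ∈ probFilter μ ↔ Tendsto (fun n => μ {ω | (n, ω) ∉ A}) atTop (𝓝 0) := Iff.rfl

lemma tendsto_fst_probFilter : Tendsto Prod.fst (probFilter μ) atTop := by
  intro s hs
  rw [mem_map, mem_probFilter_iff]
  refine tendsto_const_nhds.congr' ?_
  filter_upwards [hs] with n hn
  simp [hn]

/-- Along `probFilter` the continuous mapping theorem is composition of limits, and exceptional
events are discarded by `filter_upwards`, with no measurability to check. This equivalence is the
way back, as needed for Slutsky's theorem. -/
lemma tendsto_probFilter_iff {E : Type*} [PseudoMetricSpace E] {Y : ℕ → Ω → E} {c : E} :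
    Tendsto (fun q : ℕ × Ω => Y q.1 q.2) (probFilter μ) (𝓝 c) ↔
      TendstoInMeasure μ Y atTop (fun _ => c) := by
  rw [tendstoInMeasure_iff_dist, Metric.tendsto_nhds]
  refine forall₂_congr fun ε hε => ?_
  rw [Filter.Eventually, mem_probFilter_iff]
  simp

lemma tendsto_probFilter_of_integral_abs [IsFiniteMeasure μ] {Y : ℕ → Ω → ℝ}
    (hint : ∀ n, Integrable (Y n) μ)
    (h : Tendsto (fun n => ∫ ω, |Y n ω| ∂μ) atTop (𝓝 0)) :
    Tendsto (fun q : ℕ × Ω => Y q.1 q.2) (probFilter μ) (𝓝 0) := by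
  rw [tendsto_probFilter_iff]
  refine tendstoInMeasure_of_tendsto_eLpNorm (p := 1) one_ne_zero
    (fun n => (hint n).aestronglyMeasurable) aestronglyMeasurable_const ?_
  have : ∀ n, eLpNorm (Y n - fun _ => (0 : ℝ)) 1 μ = ENNReal.ofReal (∫ ω, |Y n ω| ∂μ) := by
    intro n
    rw [eLpNorm_one_eq_lintegral_enorm, ofReal_integral_eq_lintegral_ofReal (hint n).abs
      (.of_forall fun _ => abs_nonneg _)]
    refine lintegral_congr fun ω => ?_
    simp [← ofReal_norm]
  simp_rw [this]
  simpa using ENNReal.tendsto_ofReal h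

end ProbFilter

/-! ### A weak law of large numbers -/

section LLN

variable {Ω S : Type*} [MeasurableSpace Ω] [MeasurableSpace S] {μ : Measure Ω}
  {ν : Measure S} {O : ℕ → Ω → S}

/-- Truncation to the set where |f| ≤ T, with T large by dominated convergence. It reduces the law
of large numbers for integrable f to a variance computation. -/
lemma exists_bounded_approx {f : S → ℝ} (hfm : Measurable f) (hf : Integrable f ν) {η : ℝ}
    (hη : 0 < η) : ∃ (g : S → ℝ) (T : ℝ), Measurable g ∧ (∀ x, |g x| ≤ T) ∧
      ∫ x, |f x - g x| ∂ν < η := by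
  set g : ℕ → S → ℝ := fun T => {x | |f x| ≤ T}.indicator f with hg
  have hset : ∀ T : ℕ, MeasurableSet {x | |f x| ≤ T} := fun T =>
    measurableSet_le hfm.abs measurable_const
  have hgm : ∀ T, Measurable (g T) := fun T => hfm.indicator (hset T)
  have hle : ∀ T x, |f x - g T x| ≤ |f x| := by
    intro T x
    simp only [hg, Set.indicator]
    split_ifs <;> simp
  have hlim : Tendsto (fun T => ∫ x, |f x - g T x| ∂ν) atTop (𝓝 0) := by
    rw [← integral_zero S ℝ (μ := ν)]
    refine tendsto_integral_of_dominated_convergence (fun x => |f x|)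
      (fun T => ((hfm.sub (hgm T)).abs).aestronglyMeasurable) hf.abs
      (fun T => .of_forall fun x => by simpa using hle T x) (.of_forall fun x => ?_)
    refine tendsto_const_nhds.congr' ?_
    filter_upwards [tendsto_natCast_atTop_atTop.eventually_ge_atTop |f x|] with T hT
    simp [hg, hT]
  obtain ⟨T, hT⟩ := (hlim.eventually_lt_const hη).exists
  refine ⟨g T, T, hgm T, fun x => ?_, hT⟩
  simp only [hg, Set.indicator]
  split_ifs with h
  · exact h
  · simp

lemma integral_sq_sum_centered [IsProbabilityMeasure μ]
    (hindep : iIndepFun O μ) {g : S → ℝ} (hgm : Measurable g)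
    (hg : ∀ j, MemLp (fun ω => g (O j ω)) 2 μ) (c : ℕ → ℝ) (n : ℕ) :
    ∫ ω, (∑ j ∈ Finset.range n, c j * (g (O j ω) - ∫ ω, g (O j ω) ∂μ)) ^ 2 ∂μ
      = ∑ j ∈ Finset.range n, c j ^ 2 * Var[fun ω => g (O j ω); μ] := by
  set Z : ℕ → Ω → ℝ := fun j ω => c j * (g (O j ω) - ∫ ω, g (O j ω) ∂μ) with hZ
  have hZL : ∀ j, MemLp (Z j) 2 μ := fun j => ((hg j).sub (memLp_const _)).const_mul _
  have hZi : iIndepFun Z μ := hindep.comp (fun j x => c j * (g x - ∫ ω, g (O j ω) ∂μ))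
    (fun j => by fun_prop)
  have hZ0 : ∀ j, ∫ ω, Z j ω ∂μ = 0 := fun j => by
    simp only [hZ]
    rw [integral_const_mul, integral_sub ((hg j).integrable (by norm_num)) (integrable_const _)]
    simp
  have h1 : Var[∑ j ∈ Finset.range n, Z j; μ] = ∑ j ∈ Finset.range n, Var[Z j; μ] :=
    IndepFun.variance_sum (fun j _ => hZL j) fun i _ j _ hij => hZi.indepFun hij
  have h2 : ∀ j, Var[Z j; μ] = c j ^ 2 * Var[fun ω => g (O j ω); μ] := fun j => by
    simp only [hZ]
    rw [variance_const_mul, variance_sub_const (hg j).aestronglyMeasurable]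
  simp_rw [← h2]
  rw [← h1, variance_of_integral_eq_zero]
  · simp [hZ]
  · exact Finset.aemeasurable_sum _ fun j _ => (hZL j).aestronglyMeasurable.aemeasurable
  · simp only [Finset.sum_apply]
    rw [integral_finsetSum _ fun j _ => (hZL j).integrable (by norm_num)]
    simp [hZ0]

/-- Weak law of large numbers, in `L¹`, for weighted averages of independent variables with laws
dominated by a common finite measure. -/
theorem tendsto_integral_abs_weighted_average [IsProbabilityMeasure μ] [IsFiniteMeasure ν]
    (hO : ∀ j, Measurable (O j)) (hindep : iIndepFun O μ) (hdom : ∀ j, μ.map (O j) ≤ ν)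
    {f : S → ℝ} (hfm : Measurable f) (hf : Integrable f ν) {c : ℕ → ℕ → ℝ} {W : ℝ}
    (hc : ∀ᶠ n in atTop, ∀ j, |c n j| ≤ W) :
    Tendsto (fun n : ℕ => ∫ ω, |(1 / (n : ℝ)) * ∑ j ∈ Finset.range n,
      c n j * (f (O j ω) - ∫ ω, f (O j ω) ∂μ)| ∂μ) atTop (𝓝 0) := by
  have hW0 : 0 ≤ W := by
    obtain ⟨n, hn⟩ := hc.exists
    exact (abs_nonneg _).trans (hn 0)
  have hfO := integrable_comp_of_map_le hO hdom hf
  rw [Metric.tendsto_nhds]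
  intro ε hε
  -- Chosen so that η + 2Wη = ε/2, which leaves room for the variance term of order 1/n.
  obtain ⟨η, hηdef⟩ : ∃ η : ℝ, η = ε / (2 * (1 + 2 * W)) := ⟨_, rfl⟩
  have hη : 0 < η := by rw [hηdef]; positivity
  obtain ⟨g, T, hgm, hgT, hfg⟩ := exists_bounded_approx hfm hf hη
  have hgL : ∀ p : ENNReal, MemLp g p ν := fun p =>
    MemLp.of_bound hgm.aestronglyMeasurable T (.of_forall hgT)
  have hgO : ∀ j, MemLp (fun ω => g (O j ω)) 2 μ := memLp_comp_of_map_le hO hdom (hgL 2)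
  have hgi : Integrable g ν := (hgL 1).integrable le_rfl
  have hgOi : ∀ j, Integrable (fun ω => g (O j ω)) μ := integrable_comp_of_map_le hO hdom hgi
  have hvar : ∀ j, Var[fun ω => g (O j ω); μ] ≤ T ^ 2 := fun j => by
    refine (variance_le_expectation_sq (hgO j).aestronglyMeasurable).trans ?_
    have : ∫ ω, ((fun ω => g (O j ω)) ^ 2) ω ∂μ ≤ ∫ ω, T ^ 2 ∂μ :=
      integral_mono (hgO j).integrable_sq (integrable_const _) fun ω =>
        sq_le_sq' (abs_le.1 (hgT _)).1 (abs_le.1 (hgT _)).2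
    simpa using this
  have hlim : Tendsto (fun n : ℕ => η + W ^ 2 * T ^ 2 / η / n + 2 * W * η) atTop
      (𝓝 (η + 0 + 2 * W * η)) :=
    (tendsto_const_nhds.add (tendsto_const_div_atTop_nhds_zero_nat _)).add tendsto_const_nhds
  have hlt : η + 0 + 2 * W * η < ε := by
    have : η * (2 * (1 + 2 * W)) = ε := by rw [hηdef]; field_simp
    nlinarith
  filter_upwards [hc, eventually_gt_atTop 0, hlim.eventually_lt_const hlt] with n hn hn0 hsmall
  have hn0' : (0 : ℝ) < n := by exact_mod_cast hn0
  rw [Real.dist_eq, sub_zero, abs_of_nonneg (integral_nonneg fun ω => abs_nonneg _)]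
  refine lt_of_le_of_lt ?_ hsmall
  set A : Ω → ℝ := fun ω => (1 / (n : ℝ)) * ∑ j ∈ Finset.range n,
      c n j * (g (O j ω) - ∫ ω, g (O j ω) ∂μ) with hA
  set B : ℕ → Ω → ℝ := fun j ω => |f (O j ω) - g (O j ω)| + ∫ x, |f x - g x| ∂ν with hB
  have hfgi : Integrable (fun x => |f x - g x|) ν := (hf.sub hgi).abs
  have hBi : ∀ j, Integrable (B j) μ := fun j =>
    (integrable_comp_of_map_le hO hdom hfgi j).add (integrable_const _)
  have hA2 : Integrable (fun ω => A ω ^ 2) μ :=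
    ((memLp_finsetSum (Finset.range n) fun j _ =>
      ((hgO j).sub (memLp_const _)).const_mul (c n j)).const_mul (1 / (n : ℝ))).integrable_sq
  have hdiff : ∀ j, |∫ ω, f (O j ω) ∂μ - ∫ ω, g (O j ω) ∂μ| ≤ ∫ x, |f x - g x| ∂ν := fun j => by
    rw [← integral_sub (hfO j) (hgOi j)]
    exact abs_integral_le_integral_abs.trans
      (integral_comp_le_of_map_le hO hdom hfgi (fun x => abs_nonneg _) j)
  -- The truncated average A satisfies |A| ≤ η + A²/η, a pointwise form of Chebyshev's inequality
  -- that needs only the second moment of A. The truncation error is bounded term by term.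
  have hpt : ∀ ω, |(1 / (n : ℝ)) * ∑ j ∈ Finset.range n,
      c n j * (f (O j ω) - ∫ ω, f (O j ω) ∂μ)|
      ≤ η + A ω ^ 2 / η + 1 / n * ∑ j ∈ Finset.range n, W * B j ω := by
    intro ω
    have hsplit : (1 / (n : ℝ)) * ∑ j ∈ Finset.range n, c n j * (f (O j ω) - ∫ ω, f (O j ω) ∂μ)
        = A ω + 1 / n * ∑ j ∈ Finset.range n, c n j * ((f (O j ω) - g (O j ω))
          - (∫ ω, f (O j ω) ∂μ - ∫ ω, g (O j ω) ∂μ)) := by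
      rw [hA, ← mul_add, ← Finset.sum_add_distrib]
      congr 1
      exact Finset.sum_congr rfl fun j _ => by ring
    rw [hsplit]
    refine (abs_add_le _ _).trans (add_le_add ?_ ?_)
    · rw [← sq_abs (A ω)]
      have h0 := abs_nonneg (A ω)
      have h1 : η * (|A ω| ^ 2 / η) = |A ω| ^ 2 := by field_simp
      rcases le_or_gt |A ω| η with h | h
      · have : 0 ≤ |A ω| ^ 2 / η := by positivity
        linarith
      · have : |A ω| ≤ |A ω| ^ 2 / η := by
          rw [le_div_iff₀ hη]; nlinarith
        linarith
    · rw [abs_mul, abs_of_pos (by positivity : (0 : ℝ) < 1 / n)]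
      gcongr
      refine (Finset.abs_sum_le_sum_abs _ _).trans (Finset.sum_le_sum fun j _ => ?_)
      rw [abs_mul]
      exact mul_le_mul (hn j) ((abs_sub _ _).trans (add_le_add le_rfl (hdiff j)))
        (abs_nonneg _) hW0
  have hBsum : Integrable (fun ω => 1 / (n : ℝ) * ∑ j ∈ Finset.range n, W * B j ω) μ :=
    (integrable_finsetSum _ fun j _ => (hBi j).const_mul W).const_mul _
  have hA2' : Integrable (fun ω => η + A ω ^ 2 / η) μ :=
    (integrable_const _).add (hA2.div_const _)
  refine (integral_mono_of_nonneg (.of_forall fun ω => abs_nonneg _) (hA2'.add hBsum)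
    (.of_forall hpt)).trans ?_
  simp only [Pi.add_apply]
  rw [integral_add hA2' hBsum, integral_add (integrable_const _) (hA2.div_const _), integral_div,
    integral_const_mul, integral_finsetSum _ fun j _ => (hBi j).const_mul W]
  refine add_le_add (add_le_add (by simp) ?_) ?_
  · have : ∫ ω, A ω ^ 2 ∂μ = (1 / (n : ℝ)) ^ 2 *
        ∑ j ∈ Finset.range n, c n j ^ 2 * Var[fun ω => g (O j ω); μ] := by
      rw [← integral_sq_sum_centered hindep hgm hgO, ← integral_const_mul]
      refine integral_congr_ae (.of_forall fun ω => ?_)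
      simp only [hA]; ring
    rw [this]
    have hs : ∑ j ∈ Finset.range n, c n j ^ 2 * Var[fun ω => g (O j ω); μ]
        ≤ ∑ j ∈ Finset.range n, W ^ 2 * T ^ 2 := Finset.sum_le_sum fun j _ =>
      mul_le_mul (sq_le_sq' (abs_le.1 (hn j)).1 (abs_le.1 (hn j)).2) (hvar j)
        (variance_nonneg _ _) (by positivity)
    rw [Finset.sum_const, Finset.card_range, nsmul_eq_mul] at hs
    calc _ ≤ (1 / (n : ℝ)) ^ 2 * (n * (W ^ 2 * T ^ 2)) / η := by gcongr
      _ = _ := by field_simp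
  · have hBle : ∀ j, ∫ ω, W * B j ω ∂μ ≤ W * (2 * η) := fun j => by
      rw [integral_const_mul]
      gcongr
      simp only [hB]
      rw [integral_add (integrable_comp_of_map_le hO hdom hfgi j) (integrable_const _)]
      have := integral_comp_le_of_map_le hO hdom hfgi (fun x => abs_nonneg _) j
      simp only [integral_const, probReal_univ, one_smul]
      linarith
    calc _ ≤ 1 / (n : ℝ) * ∑ j ∈ Finset.range n, W * (2 * η) := by
          gcongr with j _; exact hBle j
      _ = _ := by
          rw [Finset.sum_const, Finset.card_range, nsmul_eq_mul]; field_simp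

/-- Weak law of large numbers for weighted averages of independent variables with laws
dominated by a common finite measure. -/
theorem tendsto_weighted_average [IsProbabilityMeasure μ] [IsFiniteMeasure ν]
    (hO : ∀ j, Measurable (O j)) (hindep : iIndepFun O μ) (hdom : ∀ j, μ.map (O j) ≤ ν)
    {f : S → ℝ} (hfm : Measurable f) (hf : Integrable f ν) {c : ℕ → ℕ → ℝ} {W : ℝ}
    (hc : ∀ᶠ n in atTop, ∀ j, |c n j| ≤ W) {e : ℝ}
    (he : ∀ᶠ n : ℕ in atTop,
      (1 / (n : ℝ)) * ∑ j ∈ Finset.range n, c n j * ∫ ω, f (O j ω) ∂μ = e) :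
    Tendsto (fun q : ℕ × Ω => (1 / (q.1 : ℝ)) * ∑ j ∈ Finset.range q.1, c q.1 j * f (O j q.2))
      (probFilter μ) (𝓝 e) := by
  have hfO := integrable_comp_of_map_le hO hdom hf
  have h := tendsto_probFilter_of_integral_abs (μ := μ)
    (Y := fun n ω => (1 / (n : ℝ)) * ∑ j ∈ Finset.range n,
      c n j * (f (O j ω) - ∫ ω, f (O j ω) ∂μ))
    (fun n => (integrable_finsetSum _ fun j _ =>
      ((hfO j).sub (integrable_const _)).const_mul _).const_mul _)
    (tendsto_integral_abs_weighted_average hO hindep hdom hfm hf hc)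
  have h2 := h.add_const e
  rw [zero_add] at h2
  refine h2.congr' ?_
  filter_upwards [tendsto_fst_probFilter.eventually he] with q hq
  rw [← hq, ← mul_add, ← Finset.sum_add_distrib]
  congr 1
  exact Finset.sum_congr rfl fun j _ => by ring

end LLN

/-! ### The law of an observed subject -/

section Model

variable {M d : ℕ}

/-- The joint law of component number, regressors and error of a subject of the `m`-th component. -/
noncomputable def componentLaw (FX : Fin M → Measure (Fin d → ℝ)) (Fe : Fin M → Measure ℝ)
    (m : Fin M) : Measure (Fin M × (Fin d → ℝ) × ℝ) :=
  ((FX m).prod (Fe m)).map fun z => (m, z)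

variable {FX : Fin M → Measure (Fin d → ℝ)} {Fe : Fin M → Measure ℝ}

instance isProbabilityMeasure_componentLaw [∀ m, IsProbabilityMeasure (FX m)]
    [∀ m, IsProbabilityMeasure (Fe m)] (m : Fin M) :
    IsProbabilityMeasure (componentLaw FX Fe m) :=
  Measure.isProbabilityMeasure_map (by fun_prop)

lemma integral_componentLaw {f : Fin M × (Fin d → ℝ) × ℝ → ℝ} (hf : Measurable f) (m : Fin M) :
    ∫ o, f o ∂(componentLaw FX Fe m) = ∫ z, f (m, z) ∂((FX m).prod (Fe m)) :=
  integral_map (by fun_prop) hf.aestronglyMeasurable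

variable {Ω : Type*} [MeasurableSpace Ω] {μ : Measure Ω}
  {p : ℕ → Fin M → ℝ} {b : Fin M → Fin d → ℝ}
  {κ : ℕ → Ω → Fin M} {X : ℕ → Ω → Fin d → ℝ} {ε : ℕ → Ω → ℝ} {Y : ℕ → Ω → ℝ}

namespace IsRegressionMixture

lemma measurable_subject (h : IsRegressionMixture μ p b FX Fe κ X ε Y) (j : ℕ) :
    Measurable fun ω => (κ j ω, X j ω, ε j ω) :=
  (h.measurable_component j).prodMk ((h.measurable_regressors j).prodMk (h.measurable_error j))

lemma prob_nonneg (h : IsRegressionMixture μ p b FX Fe κ X ε Y) (j : ℕ) (m : Fin M) :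
    0 ≤ p j m := by
  rw [← h.prob_component]; exact measureReal_nonneg

variable [IsProbabilityMeasure μ]

lemma prob_le_one (h : IsRegressionMixture μ p b FX Fe κ X ε Y) (j : ℕ) (m : Fin M) :
    p j m ≤ 1 := by
  rw [← h.prob_component]; exact measureReal_le_one

lemma sum_prob (h : IsRegressionMixture μ p b FX Fe κ X ε Y) (j : ℕ) : ∑ m, p j m = 1 := by
  have h1 := (h.measurable_component j)
  simp_rw [← h.prob_component j]
  rw [sum_measureReal_preimage_singleton _ fun m _ => h1 (measurableSet_singleton m)]
  simp

/-- Total probability over the component: on {κ j = m} the conditional joint law is a product by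
conditional independence. Where p j m = 0 no conditional law is available, but both contributions
vanish. -/
lemma map_subject (h : IsRegressionMixture μ p b FX Fe κ X ε Y) (j : ℕ) :
    μ.map (fun ω => (κ j ω, X j ω, ε j ω))
      = ∑ m, ENNReal.ofReal (p j m) • componentLaw FX Fe m := by
  have hκ := h.measurable_component j
  have hXε := (h.measurable_regressors j).prodMk (h.measurable_error j)
  ext A hA
  rw [Measure.map_apply (h.measurable_subject j) hA, Measure.finsetSum_apply]
  set B := (fun ω => (κ j ω, X j ω, ε j ω)) ⁻¹' A with hB
  have hsum : μ B = ∑ m, μ (κ j ⁻¹' {m} ∩ B) := by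
    have h1 := sum_measure_preimage_singleton (μ := μ.restrict B) (f := κ j) Finset.univ
      fun m _ => hκ (measurableSet_singleton m)
    simp only [Finset.coe_univ, Set.preimage_univ, Measure.restrict_apply_univ] at h1
    rw [← h1]
    exact Finset.sum_congr rfl fun m _ =>
      Measure.restrict_apply (hκ (measurableSet_singleton m))
  rw [hsum]
  refine Finset.sum_congr rfl fun m _ => ?_
  have hp : μ (κ j ⁻¹' {m}) = ENNReal.ofReal (p j m) := by
    rw [← h.prob_component j m, ofReal_measureReal]
  by_cases h0 : p j m = 0
  · have hz : μ (κ j ⁻¹' {m}) = 0 := by rw [hp, h0, ENNReal.ofReal_zero]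
    simp [h0, measure_mono_null Set.inter_subset_left hz]
  · have hAm : MeasurableSet ((fun z => (m, z)) ⁻¹' A) := (by fun_prop : Measurable
      (fun z : (Fin d → ℝ) × ℝ => (m, z))) hA
    have hjoint := (indepFun_iff_map_prod_eq_prod_map_map
      (h.measurable_regressors j).aemeasurable (h.measurable_error j).aemeasurable).1
      (h.condIndep j m h0)
    rw [h.law_regressors j m h0, h.law_error j m h0] at hjoint
    have hset : κ j ⁻¹' {m} ∩ B
        = κ j ⁻¹' {m} ∩ (fun ω => (X j ω, ε j ω)) ⁻¹' ((fun z => (m, z)) ⁻¹' A) := by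
      ext ω
      simp only [hB, Set.mem_inter_iff, Set.mem_preimage, Set.mem_singleton_iff]
      exact and_congr_right fun hm => by rw [hm]
    rw [hset, ← cond_mul_eq_inter (hκ (measurableSet_singleton m)), hp, mul_comm,
      Measure.smul_apply, smul_eq_mul, componentLaw, Measure.map_apply (by fun_prop) hA, ← hjoint,
      Measure.map_apply hXε hAm]

/-- The mixing probabilities are at most one. The bound does not depend on j, which supplies the
dominating measure of the limit theorems. -/
lemma map_subject_le (h : IsRegressionMixture μ p b FX Fe κ X ε Y) (j : ℕ) :
    μ.map (fun ω => (κ j ω, X j ω, ε j ω)) ≤ ∑ m, componentLaw FX Fe m := by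
  rw [h.map_subject j]
  refine Finset.sum_le_sum fun m _ => ?_
  refine Measure.le_iff.2 fun A _ => ?_
  rw [Measure.smul_apply, smul_eq_mul]
  exact mul_le_of_le_one_left zero_le (ENNReal.ofReal_le_one.2 (h.prob_le_one j m))

lemma integral_subject (h : IsRegressionMixture μ p b FX Fe κ X ε Y)
    {f : Fin M × (Fin d → ℝ) × ℝ → ℝ} (hf : ∀ m, Integrable f (componentLaw FX Fe m)) (j : ℕ) :
    ∫ ω, f (κ j ω, X j ω, ε j ω) ∂μ = ∑ m, p j m * ∫ o, f o ∂(componentLaw FX Fe m) := by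
  have hi : ∀ m ∈ Finset.univ, Integrable f (ENNReal.ofReal (p j m) • componentLaw FX Fe m) :=
    fun m _ => (hf m).smul_measure ENNReal.ofReal_ne_top
  rw [← integral_map (f := f) (h.measurable_subject j).aemeasurable, h.map_subject j,
    integral_finsetSum_measure hi]
  · refine Finset.sum_congr rfl fun m _ => ?_
    rw [integral_smul_measure, ENNReal.toReal_ofReal (h.prob_nonneg j m), smul_eq_mul]
  · rw [h.map_subject j]
    exact (integrable_finsetSum_measure.2 hi).aestronglyMeasurable

end IsRegressionMixture

end Model

/-! ### Minimax weights -/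

section Weights

variable {M : ℕ} {p : ℕ → Fin M → ℝ}

/-- The average is an entry of (det Γ)⁻¹ adj(Γ) Γ, hence of the identity matrix. -/
lemma average_weight_mul_prob {n : ℕ} (hn : (gramMatrix p n).det ≠ 0) (k m : Fin M) :
    (1 / (n : ℝ)) * ∑ j ∈ Finset.range n, weight p k n j * p j m = if k = m then 1 else 0 := by
  have h1 : ((gramMatrix p n).adjugate * gramMatrix p n) k m
      = (gramMatrix p n).det * if k = m then 1 else 0 := by
    rw [Matrix.adjugate_mul, Matrix.smul_apply, Matrix.one_apply, smul_eq_mul]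
  have h2 : (1 / (n : ℝ)) * ∑ j ∈ Finset.range n, weight p k n j * p j m
      = 1 / (gramMatrix p n).det * ((gramMatrix p n).adjugate * gramMatrix p n) k m := by
    simp only [weight, Matrix.mul_apply, gramMatrix, Matrix.of_apply, Finset.mul_sum,
      Finset.sum_mul]
    rw [Finset.sum_comm]
    refine Finset.sum_congr rfl fun l _ => Finset.sum_congr rfl fun j _ => ?_
    ring
  rw [h2, h1]
  field_simp

/-- The Gram matrices lie in the compact cube of matrices with entries in [0, 1], on which the
entries of the adjugate are bounded by continuity; the determinant in the denominator exceeds C. -/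
lemma exists_abs_weight_le (hp0 : ∀ j m, 0 ≤ p j m) (hp1 : ∀ j m, p j m ≤ 1)
    (hΓ : ∃ C : ℝ, 0 < C ∧ ∀ᶠ n in atTop, C < (gramMatrix p n).det) (k : Fin M) :
    ∃ W : ℝ, ∀ᶠ n in atTop, ∀ j, |weight p k n j| ≤ W := by
  obtain ⟨C, hC, hdet⟩ := hΓ
  have hcpt : IsCompact {A : Matrix (Fin M) (Fin M) ℝ | ∀ i l, A i l ∈ Set.Icc (0 : ℝ) 1} := by
    have : {A : Matrix (Fin M) (Fin M) ℝ | ∀ i l, A i l ∈ Set.Icc (0 : ℝ) 1}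
        = Set.univ.pi fun _ => Set.univ.pi fun _ => Set.Icc (0 : ℝ) 1 := by
      ext A
      exact ⟨fun h i _ l _ => h i l, fun h i l => h i trivial l trivial⟩
    rw [this]
    exact isCompact_univ_pi fun _ => isCompact_univ_pi fun _ => isCompact_Icc
  have hmem : ∀ n, gramMatrix p n ∈ {A : Matrix (Fin M) (Fin M) ℝ |
      ∀ i l, A i l ∈ Set.Icc (0 : ℝ) 1} := by
    intro n i l
    simp only [gramMatrix, Matrix.of_apply]
    constructor
    · exact mul_nonneg (by positivity)
        (Finset.sum_nonneg fun j _ => mul_nonneg (hp0 _ _) (hp0 _ _))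
    · have : ∑ j ∈ Finset.range n, p j i * p j l ≤ ∑ j ∈ Finset.range n, (1 : ℝ) :=
        Finset.sum_le_sum fun j _ => mul_le_one₀ (hp1 _ _) (hp0 _ _) (hp1 _ _)
      rw [Finset.sum_const, Finset.card_range, nsmul_eq_mul, mul_one] at this
      rw [one_div_mul_eq_div]
      exact div_le_one_of_le₀ this n.cast_nonneg
  have hbd : ∀ m, ∃ R : ℝ, ∀ n, |(gramMatrix p n).adjugate k m| ≤ R := by
    intro m
    obtain ⟨R, hR⟩ := hcpt.exists_bound_of_continuousOn
      (f := fun A : Matrix (Fin M) (Fin M) ℝ => A.adjugate k m)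
      ((continuous_id.matrix_adjugate.matrix_elem k m).continuousOn)
    exact ⟨R, fun n => hR _ (hmem n)⟩
  choose R hR using hbd
  refine ⟨1 / C * ∑ m, R m, ?_⟩
  filter_upwards [hdet] with n hn j
  have hdp := hC.trans hn
  rw [weight, abs_mul, abs_of_pos (by positivity : 0 < 1 / (gramMatrix p n).det)]
  refine mul_le_mul (one_div_le_one_div_of_le hC hn.le) ?_ (abs_nonneg _) (by positivity)
  refine (Finset.abs_sum_le_sum_abs _ _).trans (Finset.sum_le_sum fun m _ => ?_)
  rw [abs_mul, abs_of_nonneg (hp0 j m)]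
  exact (mul_le_of_le_one_right (abs_nonneg _) (hp1 j m)).trans (hR m n)

end Weights

/-! ### Moments within a component -/

section Moments

lemma memLp_four_of_integrable_pow {α : Type*} [MeasurableSpace α] {P : Measure α} {f : α → ℝ}
    (hfm : Measurable f) (hf : Integrable (fun x => f x ^ 4) P) : MemLp f 4 P := by
  rw [← integrable_norm_rpow_iff hfm.aestronglyMeasurable (by norm_num) (by norm_num)]
  refine hf.congr (.of_forall fun x => ?_)
  have h4 : (4 : ENNReal).toReal = ((4 : ℕ) : ℝ) := by norm_num
  simp only [h4, Real.rpow_natCast, Real.norm_eq_abs]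
  exact (Even.pow_abs (by decide) _).symm

lemma memLp_two_mul {α : Type*} [MeasurableSpace α] {P : Measure α} {f g : α → ℝ}
    (hf : MemLp f 4 P) (hg : MemLp g 4 P) : MemLp (fun x => f x * g x) 2 P := by
  have : ENNReal.HolderTriple 4 4 2 := ⟨by
    rw [← two_mul, show (4 : ENNReal) = 2 * 2 by norm_num, ENNReal.mul_inv (by simp) (by simp),
      ← mul_assoc, ENNReal.mul_inv_cancel (by simp) (by simp), one_mul]⟩
  exact hg.mul hf

lemma integrable_mul_of_memLp_two {α : Type*} [MeasurableSpace α] {P : Measure α} {f g : α → ℝ}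
    (hf : MemLp f 2 P) (hg : MemLp g 2 P) : Integrable (fun x => f x * g x) P :=
  hf.integrable_mul hg

variable {d : ℕ} {F : Measure (Fin d → ℝ)} {G : Measure ℝ}

lemma integral_mul_dotProduct {h : (Fin d → ℝ) → ℝ}
    (hi : ∀ q, Integrable (fun x => h x * x q) F) (δ : Fin d → ℝ) :
    ∫ x, h x * (δ ⬝ᵥ x) ∂F = (fun q => ∫ x, h x * x q ∂F) ⬝ᵥ δ := by
  have : ∀ x, h x * (δ ⬝ᵥ x) = ∑ q, δ q * (h x * x q) := fun x => by
    rw [dotProduct, Finset.mul_sum]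
    exact Finset.sum_congr rfl fun q _ => by ring
  simp_rw [this]
  rw [integral_finsetSum _ fun q _ => (hi q).const_mul _, dotProduct]
  exact Finset.sum_congr rfl fun q _ => by rw [integral_const_mul, mul_comm]

lemma integrable_mul_dotProduct {h : (Fin d → ℝ) → ℝ}
    (hi : ∀ q, Integrable (fun x => h x * x q) F) (δ : Fin d → ℝ) :
    Integrable (fun x => h x * (δ ⬝ᵥ x)) F := by
  have : (fun x => h x * (δ ⬝ᵥ x)) = fun x => ∑ q, δ q * (h x * x q) := by
    ext x
    rw [dotProduct, Finset.mul_sum]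
    exact Finset.sum_congr rfl fun q _ => by ring
  rw [this]
  exact integrable_finsetSum _ fun q _ => (hi q).const_mul _

lemma integral_mul_dotProduct_sq {h : (Fin d → ℝ) → ℝ}
    (hi : ∀ l q, Integrable (fun x => h x * x l * x q) F) (δ : Fin d → ℝ) :
    Integrable (fun x => h x * (δ ⬝ᵥ x) ^ 2) F ∧ ∫ x, h x * (δ ⬝ᵥ x) ^ 2 ∂F
      = δ ⬝ᵥ ((Matrix.of fun l q => ∫ x, h x * x l * x q ∂F) *ᵥ δ) := by
  have h1 : ∀ x, h x * (δ ⬝ᵥ x) ^ 2 = ∑ l, δ l * (h x * x l * (δ ⬝ᵥ x)) := fun x => by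
    have : h x * (δ ⬝ᵥ x) ^ 2 = h x * (δ ⬝ᵥ x) * ∑ l, δ l * x l := by rw [sq, ← mul_assoc]; rfl
    rw [this, Finset.mul_sum]
    exact Finset.sum_congr rfl fun q _ => by ring
  have h2 : ∀ l, Integrable (fun x => δ l * (h x * x l * (δ ⬝ᵥ x))) F := fun l =>
    (integrable_mul_dotProduct (hi l) δ).const_mul _
  simp_rw [h1]
  refine ⟨integrable_finsetSum _ fun l _ => h2 l, ?_⟩
  rw [integral_finsetSum _ fun l _ => h2 l, dotProduct]
  refine Finset.sum_congr rfl fun l _ => ?_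
  rw [integral_const_mul, integral_mul_dotProduct (hi l)]
  rfl

variable [IsProbabilityMeasure F] [IsProbabilityMeasure G]

lemma integral_mul_linear_add_error {h : (Fin d → ℝ) → ℝ} (hh : Integrable h F)
    (hi : ∀ q, Integrable (fun x => h x * x q) F) (hG : Integrable (fun e => e) G)
    (hG0 : ∫ e, e ∂G = 0) (δ : Fin d → ℝ) :
    ∫ z, h z.1 * (δ ⬝ᵥ z.1 + z.2) ∂(F.prod G) = (fun q => ∫ x, h x * x q ∂F) ⬝ᵥ δ := by
  simp_rw [mul_add]
  have h1 : Integrable (fun z : (Fin d → ℝ) × ℝ => h z.1 * (δ ⬝ᵥ z.1)) (F.prod G) :=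
    (integrable_mul_dotProduct hi δ).comp_fst G
  have h2 : Integrable (fun z : (Fin d → ℝ) × ℝ => h z.1 * z.2) (F.prod G) := hh.mul_prod hG
  rw [integral_add h1 h2, integral_prod_mul h (fun e => e), hG0, mul_zero, add_zero,
    integral_fun_fst (fun x => h x * (δ ⬝ᵥ x)), integral_mul_dotProduct hi]
  simp

/-- The cross term factors over the product measure and vanishes with the mean of the error. The
factor h is left free: h = 1 gives the second moment of the residual, h = x i * x l the second
moments of the score. -/
lemma integral_mul_linear_add_error_sq {h : (Fin d → ℝ) → ℝ} (hh : Integrable h F)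
    (hi : ∀ q, Integrable (fun x => h x * x q) F)
    (hii : ∀ l q, Integrable (fun x => h x * x l * x q) F) (hG : MemLp (fun e => e) 2 G)
    (hG0 : ∫ e, e ∂G = 0) (δ : Fin d → ℝ) :
    ∫ z, h z.1 * (δ ⬝ᵥ z.1 + z.2) ^ 2 ∂(F.prod G)
      = δ ⬝ᵥ ((Matrix.of fun l q => ∫ x, h x * x l * x q ∂F) *ᵥ δ)
        + (∫ x, h x ∂F) * variance id G := by
  have hexp : ∀ z : (Fin d → ℝ) × ℝ, h z.1 * (δ ⬝ᵥ z.1 + z.2) ^ 2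
      = h z.1 * (δ ⬝ᵥ z.1) ^ 2 + (2 * (h z.1 * (δ ⬝ᵥ z.1)) * z.2 + h z.1 * z.2 ^ 2) :=
    fun z => by ring
  simp_rw [hexp]
  obtain ⟨hq, hq'⟩ := integral_mul_dotProduct_sq hii δ
  have hlin := (integrable_mul_dotProduct hi δ).const_mul 2
  have h1 : Integrable (fun z : (Fin d → ℝ) × ℝ => h z.1 * (δ ⬝ᵥ z.1) ^ 2) (F.prod G) :=
    hq.comp_fst G
  have h2 : Integrable (fun z : (Fin d → ℝ) × ℝ => 2 * (h z.1 * (δ ⬝ᵥ z.1)) * z.2) (F.prod G) :=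
    hlin.mul_prod (hG.integrable (by norm_num))
  have h3 : Integrable (fun z : (Fin d → ℝ) × ℝ => h z.1 * z.2 ^ 2) (F.prod G) :=
    hh.mul_prod hG.integrable_sq
  have h23 : Integrable (fun z : (Fin d → ℝ) × ℝ => 2 * (h z.1 * (δ ⬝ᵥ z.1)) * z.2
      + h z.1 * z.2 ^ 2) (F.prod G) := h2.add h3
  rw [integral_add h1 h23, integral_add h2 h3,
    integral_fun_fst (fun x => h x * (δ ⬝ᵥ x) ^ 2), hq',
    integral_prod_mul (fun x => 2 * (h x * (δ ⬝ᵥ x))) (fun e => e), hG0,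
    integral_prod_mul h (fun e => e ^ 2),
    variance_of_integral_eq_zero (by fun_prop) (by simpa using hG0)]
  simp

end Moments

lemma integrable_regressor_mul_four {d : ℕ} {F : Measure (Fin d → ℝ)}
    (hX4 : ∀ i, Integrable (fun x : Fin d → ℝ => x i ^ 4) F) (i s l q : Fin d) :
    Integrable (fun x => x i * x s * x l * x q) F := by
  have h := fun i => memLp_four_of_integrable_pow (measurable_pi_apply i) (hX4 i)
  simp_rw [mul_assoc _ _ ((_ : Fin d → ℝ) q)]
  exact integrable_mul_of_memLp_two (memLp_two_mul (h i) (h s)) (memLp_two_mul (h l) (h q))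

/-! ### Moments of residuals and scores within a component -/

section ComponentMoments

variable {M d : ℕ} {FX : Fin M → Measure (Fin d → ℝ)} {Fe : Fin M → Measure ℝ}

/-- The residual `Y - Xᵀ β` of a subject with component number `o.1`, regressors `o.2.1` and
error `o.2.2`. -/
def residual (b : Fin M → Fin d → ℝ) (β : Fin d → ℝ) (o : Fin M × (Fin d → ℝ) × ℝ) : ℝ :=
  b o.1 ⬝ᵥ o.2.1 + o.2.2 - β ⬝ᵥ o.2.1

lemma residual_mk (b : Fin M → Fin d → ℝ) (β : Fin d → ℝ) (m : Fin M) (z : (Fin d → ℝ) × ℝ) :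
    residual b β (m, z) = (b m - β) ⬝ᵥ z.1 + z.2 := by
  simp only [residual, sub_dotProduct]; ring

@[fun_prop]
lemma measurable_residual (b : Fin M → Fin d → ℝ) (β : Fin d → ℝ) :
    Measurable (residual b β) := by
  unfold residual dotProduct
  have hb : ∀ i, Measurable fun m : Fin M => b m i := fun i => measurable_of_finite _
  have : ∀ i, Measurable fun o : Fin M × (Fin d → ℝ) × ℝ => b o.1 i := fun i =>
    (hb i).comp measurable_fst
  fun_prop

lemma memLp_two_sum {f : Fin M × (Fin d → ℝ) × ℝ → ℝ} (hfm : Measurable f)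
    (hf : ∀ m, MemLp f 2 (componentLaw FX Fe m)) : MemLp f 2 (∑ m, componentLaw FX Fe m) := by
  rw [memLp_two_iff_integrable_sq hfm.aestronglyMeasurable, integrable_finsetSum_measure]
  exact fun m _ => (hf m).integrable_sq

variable [∀ m, IsProbabilityMeasure (Fe m)]

lemma memLp_four_regressor (hX4 : ∀ m i, Integrable (fun x : Fin d → ℝ => x i ^ 4) (FX m))
    (m : Fin M) (i : Fin d) : MemLp (fun o => o.2.1 i) 4 (componentLaw FX Fe m) := by
  rw [componentLaw, memLp_map_measure_iff (by fun_prop) (by fun_prop)]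
  exact (memLp_four_of_integrable_pow (measurable_pi_apply i) (hX4 m i)).comp_fst _

variable [∀ m, IsProbabilityMeasure (FX m)]

lemma memLp_four_residual (hX4 : ∀ m i, Integrable (fun x : Fin d → ℝ => x i ^ 4) (FX m))
    (he4 : ∀ m, Integrable (fun e : ℝ => e ^ 4) (Fe m)) (b : Fin M → Fin d → ℝ) (β : Fin d → ℝ)
    (m : Fin M) : MemLp (residual b β) 4 (componentLaw FX Fe m) := by
  rw [componentLaw, memLp_map_measure_iff (by fun_prop) (by fun_prop)]
  have h : (residual b β) ∘ (fun z => (m, z)) = fun z => (∑ i, (b m - β) i * z.1 i) + z.2 := by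
    ext z; exact residual_mk b β m z
  rw [h]
  exact (memLp_finsetSum _ fun i _ => ((memLp_four_of_integrable_pow (measurable_pi_apply i)
    (hX4 m i)).comp_fst _).const_mul _).add
    ((memLp_four_of_integrable_pow measurable_id (he4 m)).comp_snd _)

lemma integral_regressor_mul (m : Fin M) (i s : Fin d) :
    ∫ o, o.2.1 i * o.2.1 s ∂(componentLaw FX Fe m) = secondMoment (FX m) i s := by
  rw [integral_componentLaw (by fun_prop),
    integral_fun_fst (fun x : Fin d → ℝ => x i * x s)]
  simp [secondMoment]

lemma integral_regressor_mul_four (m : Fin M) (i s l q : Fin d) :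
    ∫ o, o.2.1 i * o.2.1 s * (o.2.1 l * o.2.1 q) ∂(componentLaw FX Fe m)
      = fourthMoment (FX m) i s l q := by
  rw [integral_componentLaw (by fun_prop),
    integral_fun_fst (fun x : Fin d → ℝ => x i * x s * (x l * x q))]
  simp [fourthMoment, mul_assoc]

variable {m : Fin M}

lemma integrable_regressor_mul (hX4 : ∀ i, Integrable (fun x : Fin d → ℝ => x i ^ 4) (FX m))
    (i s : Fin d) : Integrable (fun x => x i * x s) (FX m) :=
  (memLp_two_mul (memLp_four_of_integrable_pow (measurable_pi_apply i) (hX4 i))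
    (memLp_four_of_integrable_pow (measurable_pi_apply s) (hX4 s))).integrable (by norm_num)

lemma integrable_regressor (hX4 : ∀ i, Integrable (fun x : Fin d → ℝ => x i ^ 4) (FX m))
    (i : Fin d) : Integrable (fun x => x i) (FX m) :=
  (memLp_four_of_integrable_pow (measurable_pi_apply i) (hX4 i)).integrable (by norm_num)

/-- At β = b m the right-hand side vanishes, which centers the score within its own component. At β
= 0 the residual is the response, and the formula gives the limit of the averages of X Y. -/
lemma integral_regressor_mul_residual
    (hX4 : ∀ i, Integrable (fun x : Fin d → ℝ => x i ^ 4) (FX m))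
    (he4 : Integrable (fun e : ℝ => e ^ 4) (Fe m)) (he0 : ∫ e, e ∂(Fe m) = 0)
    (b : Fin M → Fin d → ℝ) (β : Fin d → ℝ) (i : Fin d) :
    ∫ o, o.2.1 i * residual b β o ∂(componentLaw FX Fe m)
      = (secondMoment (FX m) *ᵥ (b m - β)) i := by
  rw [integral_componentLaw (by fun_prop)]
  simp_rw [residual_mk]
  rw [integral_mul_linear_add_error (h := fun x => x i) (integrable_regressor hX4 i)
    (integrable_regressor_mul hX4 i)
    ((memLp_four_of_integrable_pow measurable_id he4).integrable (by norm_num)) he0]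
  rfl

lemma integral_residual_sq
    (hX4 : ∀ i, Integrable (fun x : Fin d → ℝ => x i ^ 4) (FX m))
    (he4 : Integrable (fun e : ℝ => e ^ 4) (Fe m)) (he0 : ∫ e, e ∂(Fe m) = 0)
    (b : Fin M → Fin d → ℝ) (β : Fin d → ℝ) :
    ∫ o, residual b β o ^ 2 ∂(componentLaw FX Fe m)
      = (b m - β) ⬝ᵥ (secondMoment (FX m) *ᵥ (b m - β)) + variance id (Fe m) := by
  rw [integral_componentLaw (by fun_prop)]
  simp_rw [residual_mk]
  have h := integral_mul_linear_add_error_sq (F := FX m) (G := Fe m) (h := fun _ => 1)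
    (integrable_const _)
    (fun q => by simpa using integrable_regressor hX4 q)
    (fun l q => by simpa using integrable_regressor_mul hX4 l q)
    ((memLp_four_of_integrable_pow measurable_id he4).mono_exponent (by norm_num)) he0 (b m - β)
  simpa [secondMoment] using h

/-- The source of the first sum in Σ: the error contributes the variance term, and the mismatch b m
- β of the coefficients the fourth moment term. -/
lemma integral_score_mul_score
    (hX4 : ∀ i, Integrable (fun x : Fin d → ℝ => x i ^ 4) (FX m))
    (he4 : Integrable (fun e : ℝ => e ^ 4) (Fe m)) (he0 : ∫ e, e ∂(Fe m) = 0)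
    (b : Fin M → Fin d → ℝ) (β : Fin d → ℝ) (i l : Fin d) :
    ∫ o, (o.2.1 i * residual b β o) * (o.2.1 l * residual b β o) ∂(componentLaw FX Fe m)
      = secondMoment (FX m) i l * variance id (Fe m)
        + (b m - β) ⬝ᵥ (fourthMoment (FX m) i l *ᵥ (b m - β)) := by
  rw [integral_componentLaw (by fun_prop)]
  simp_rw [residual_mk]
  have h := integral_mul_linear_add_error_sq (F := FX m) (G := Fe m) (h := fun x => x i * x l)
    (integrable_regressor_mul hX4 i l)
    (fun q => by
      have h := fun i => memLp_four_of_integrable_pow (measurable_pi_apply i) (hX4 i)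
      exact integrable_mul_of_memLp_two (memLp_two_mul (h i) (h l))
        ((h q).mono_exponent (by norm_num)))
    (fun r q => integrable_regressor_mul_four hX4 i l r q)
    ((memLp_four_of_integrable_pow measurable_id he4).mono_exponent (by norm_num)) he0 (b m - β)
  rw [add_comm, secondMoment, Matrix.of_apply, fourthMoment, ← h]
  refine integral_congr_ae (.of_forall fun z => ?_)
  simp only
  ring

end ComponentMoments

/-- The matrix `Σ` in terms of the first and second moments `u`, `w` of the score
`X (Y - Xᵀ b k)` within the components. -/
lemma sigmaMatrix_apply {M d : ℕ} (k : Fin M) (α : Fin M → Fin M → ℝ)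
    (D : Fin M → Matrix (Fin d) (Fin d) ℝ) (L : Fin M → Fin d → Fin d → Matrix (Fin d) (Fin d) ℝ)
    (b : Fin M → Fin d → ℝ) (σ2 : Fin M → ℝ) (i l : Fin d) :
    sigmaMatrix k α D L b σ2 i l
      = (∑ s, (∑ q, α s q) * (D s i l * σ2 s + (b s - b k) ⬝ᵥ (L s i l *ᵥ (b s - b k))))
        - ∑ s, ∑ m, α s m * ((D s *ᵥ (b s - b k)) i * (D m *ᵥ (b m - b k)) l) := by
  simp only [sigmaMatrix, Matrix.of_apply]
  congr 1
  refine Finset.sum_congr rfl fun s _ => Finset.sum_congr rfl fun m _ => ?_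
  congr 1
  simp only [Matrix.mulVec, dotProduct, Matrix.of_apply]
  rw [Finset.sum_mul_sum]
  simp only [Finset.mul_sum]
  refine Finset.sum_congr rfl fun q _ => Finset.sum_congr rfl fun r _ => ?_
  ring

/-! ### Algebra of the weighted least squares estimator -/

section Estimators

variable {M d : ℕ} {p : ℕ → Fin M → ℝ} {x : ℕ → Fin d → ℝ} {y : ℕ → ℝ} {n : ℕ}

lemma secondMomentHat_mulVec (m : Fin M) (β : Fin d → ℝ) (i : Fin d) :
    (secondMomentHat p x n m *ᵥ β) i
      = (1 / (n : ℝ)) * ∑ j ∈ Finset.range n, weight p m n j * (x j i * (β ⬝ᵥ x j)) := by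
  simp only [Matrix.mulVec, dotProduct, secondMomentHat, Matrix.of_apply, Finset.mul_sum,
    Finset.sum_mul]
  rw [Finset.sum_comm]
  refine Finset.sum_congr rfl fun j _ => Finset.sum_congr rfl fun s _ => ?_
  ring

/-- Both XᵀAX and XᵀAY are n times weighted averages, and the two factors n cancel. -/
lemma lsEstimator_eq (hn : n ≠ 0) {m : Fin M} (hdet : (secondMomentHat p x n m).det ≠ 0) :
    lsEstimator p x y m n = (secondMomentHat p x n m)⁻¹ *ᵥ
      fun i => (1 / (n : ℝ)) * ∑ j ∈ Finset.range n, weight p m n j * (x j i * y j) := by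
  have hn' : (n : ℝ) ≠ 0 := Nat.cast_ne_zero.2 hn
  have h1 : ∀ i s, ((Matrix.of fun (j : Fin n) i => x j i)ᵀ
      * (Matrix.diagonal fun j : Fin n => weight p m n j) * (Matrix.of fun (j : Fin n) i => x j i))
      i s = ((n : ℝ) • secondMomentHat p x n m) i s := by
    intro i s
    rw [Matrix.mul_apply, Matrix.smul_apply, secondMomentHat, Matrix.of_apply, Finset.sum_range,
      smul_eq_mul, ← mul_assoc, mul_one_div_cancel hn', one_mul]
    refine Finset.sum_congr rfl fun j _ => ?_
    rw [Matrix.mul_diagonal]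
    simp only [Matrix.transpose_apply, Matrix.of_apply]
    ring
  have h2 : ((Matrix.of fun (j : Fin n) i => x j i)ᵀ
      * (Matrix.diagonal fun j : Fin n => weight p m n j)) *ᵥ (fun j : Fin n => y j)
      = (n : ℝ) • fun i => (1 / (n : ℝ)) * ∑ j ∈ Finset.range n,
        weight p m n j * (x j i * y j) := by
    ext i
    rw [Matrix.mulVec, dotProduct, Pi.smul_apply, Finset.sum_range, smul_eq_mul, ← mul_assoc,
      mul_one_div_cancel hn', one_mul]
    refine Finset.sum_congr rfl fun j _ => ?_
    rw [Matrix.mul_diagonal]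
    simp only [Matrix.transpose_apply, Matrix.of_apply]
    ring
  have hu : IsUnit (secondMomentHat p x n m).det := isUnit_iff_ne_zero.2 hdet
  have : Invertible (n : ℝ) := invertibleOfNonzero hn'
  rw [lsEstimator, Matrix.ext h1, h2, Matrix.inv_smul _ _ hu, Matrix.smul_mulVec, Matrix.mulVec_smul, smul_smul]
  simp

/-- Writing β as D̂⁻¹ D̂ β turns the estimation error into D̂⁻¹ applied to the weighted average of
the scores at β. -/
lemma lsEstimator_sub_eq (hn : n ≠ 0) {m : Fin M} (hdet : (secondMomentHat p x n m).det ≠ 0)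
    (β : Fin d → ℝ) : lsEstimator p x y m n - β = (secondMomentHat p x n m)⁻¹ *ᵥ
      fun i => (1 / (n : ℝ)) * ∑ j ∈ Finset.range n,
        weight p m n j * (x j i * (y j - β ⬝ᵥ x j)) := by
  have hu : IsUnit (secondMomentHat p x n m).det := isUnit_iff_ne_zero.2 hdet
  have hβ : β = (secondMomentHat p x n m)⁻¹ *ᵥ (secondMomentHat p x n m *ᵥ β) := by
    rw [Matrix.mulVec_mulVec, Matrix.nonsing_inv_mul _ hu, Matrix.one_mulVec]
  conv_lhs => rw [lsEstimator_eq hn hdet, hβ]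
  rw [← Matrix.mulVec_sub]
  congr 1
  ext i
  rw [Pi.sub_apply, secondMomentHat_mulVec, ← mul_sub, ← Finset.sum_sub_distrib]
  congr 1
  exact Finset.sum_congr rfl fun j _ => by ring

/-- Expanding the square moves the random coefficient estimate outside the averages, so that the law
of large numbers applies to each average separately. -/
lemma errorVarHat_eq (m : Fin M) :
    errorVarHat p x y n m = (1 / (n : ℝ)) * (∑ j ∈ Finset.range n, weight p m n j * y j ^ 2)
      - 2 * (lsEstimator p x y m n ⬝ᵥ fun i => (1 / (n : ℝ)) *
          ∑ j ∈ Finset.range n, weight p m n j * (x j i * y j))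
      + lsEstimator p x y m n ⬝ᵥ (secondMomentHat p x n m *ᵥ lsEstimator p x y m n) := by
  set β := lsEstimator p x y m n with hβ
  have h1 : (β ⬝ᵥ fun i => (1 / (n : ℝ)) *
      ∑ j ∈ Finset.range n, weight p m n j * (x j i * y j))
      = (1 / (n : ℝ)) * ∑ j ∈ Finset.range n, weight p m n j * (y j * (x j ⬝ᵥ β)) := by
    simp only [dotProduct, Finset.mul_sum]
    rw [Finset.sum_comm]
    exact Finset.sum_congr rfl fun j _ => Finset.sum_congr rfl fun s _ => by ring
  have h2 : β ⬝ᵥ (secondMomentHat p x n m *ᵥ β)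
      = (1 / (n : ℝ)) * ∑ j ∈ Finset.range n, weight p m n j * (x j ⬝ᵥ β) ^ 2 := by
    have : ∀ j, weight p m n j * (x j ⬝ᵥ β) ^ 2
        = ∑ i, β i * (weight p m n j * (x j i * (β ⬝ᵥ x j))) := fun j => by
      rw [sq, dotProduct_comm β, ← mul_assoc]
      conv_lhs => enter [1, 2]; rw [dotProduct]
      rw [Finset.mul_sum, Finset.sum_mul]
      exact Finset.sum_congr rfl fun s _ => by ring
    simp_rw [this]
    rw [dotProduct, Finset.sum_comm, Finset.mul_sum]
    refine Finset.sum_congr rfl fun i _ => ?_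
    rw [secondMomentHat_mulVec, ← Finset.mul_sum]
    ring
  rw [h1, h2, errorVarHat, ← hβ, mul_left_comm, ← mul_sub, ← mul_add,
    Finset.mul_sum _ _ (2 : ℝ), ← Finset.sum_sub_distrib, ← Finset.sum_add_distrib]
  congr 1
  exact Finset.sum_congr rfl fun j _ => by ring

lemma secondMomentHat_isSymm (m : Fin M) : (secondMomentHat p x n m)ᵀ = secondMomentHat p x n m := by
  ext i s
  simp only [Matrix.transpose_apply, secondMomentHat, Matrix.of_apply]
  congr 1
  exact Finset.sum_congr rfl fun j _ => by ring

end Estimators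

/-! ### Continuity of the dispersion matrix -/

section Continuity

variable {T : Type*} {l : Filter T} {M d : ℕ}

lemma tendsto_matrix_inv {A : T → Matrix (Fin d) (Fin d) ℝ} {B : Matrix (Fin d) (Fin d) ℝ}
    (hA : Tendsto A l (𝓝 B)) (hB : B.det ≠ 0) : Tendsto (fun t => (A t)⁻¹) l (𝓝 B⁻¹) := by
  simp_rw [Matrix.inv_def, Ring.inverse_eq_inv']
  exact (((continuous_id.matrix_det.tendsto B).comp hA).inv₀ hB).smul
    ((continuous_id.matrix_adjugate.tendsto B).comp hA)

lemma tendsto_mulVec {A : T → Matrix (Fin d) (Fin d) ℝ} {B : Matrix (Fin d) (Fin d) ℝ}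
    {u : T → Fin d → ℝ} {v : Fin d → ℝ} (hA : Tendsto A l (𝓝 B)) (hu : Tendsto u l (𝓝 v)) :
    Tendsto (fun t => A t *ᵥ u t) l (𝓝 (B *ᵥ v)) :=
  ((continuous_fst.matrix_mulVec continuous_snd).tendsto (B, v)).comp (hA.prodMk_nhds hu)

lemma tendsto_dotProduct {u u' : T → Fin d → ℝ} {v v' : Fin d → ℝ} (hu : Tendsto u l (𝓝 v))
    (hu' : Tendsto u' l (𝓝 v')) : Tendsto (fun t => u t ⬝ᵥ u' t) l (𝓝 (v ⬝ᵥ v')) :=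
  ((continuous_fst.dotProduct continuous_snd).tendsto (v, v')).comp (hu.prodMk_nhds hu')

/-- The filter is arbitrary because two are needed: `probFilter` for the plug-in estimator, and
`atTop` for the exact covariance at sample size n, where only `alphaHat` varies. -/
lemma tendsto_sigmaMatrix (k : Fin M) {α : T → Fin M → Fin M → ℝ}
    {D : T → Fin M → Matrix (Fin d) (Fin d) ℝ}
    {L : T → Fin M → Fin d → Fin d → Matrix (Fin d) (Fin d) ℝ} {b : T → Fin M → Fin d → ℝ}
    {σ2 : T → Fin M → ℝ} {α' : Fin M → Fin M → ℝ} {D' : Fin M → Matrix (Fin d) (Fin d) ℝ}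
    {L' : Fin M → Fin d → Fin d → Matrix (Fin d) (Fin d) ℝ} {b' : Fin M → Fin d → ℝ}
    {σ2' : Fin M → ℝ} (hα : Tendsto α l (𝓝 α')) (hD : Tendsto D l (𝓝 D'))
    (hL : Tendsto L l (𝓝 L')) (hb : Tendsto b l (𝓝 b')) (hσ : Tendsto σ2 l (𝓝 σ2')) :
    Tendsto (fun t => sigmaMatrix k (α t) (D t) (L t) (b t) (σ2 t)) l
      (𝓝 (sigmaMatrix k α' D' L' b' σ2')) := by
  have hDe : ∀ s i r, Tendsto (fun t => D t s i r) l (𝓝 (D' s i r)) := fun s i r =>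
    ((continuous_id.matrix_elem i r).tendsto _).comp (tendsto_pi_nhds.1 hD s)
  have hLe : ∀ s i r, Tendsto (fun t => L t s i r) l (𝓝 (L' s i r)) := fun s i r =>
    tendsto_pi_nhds.1 (tendsto_pi_nhds.1 (tendsto_pi_nhds.1 hL s) i) r
  have hαe : ∀ s q, Tendsto (fun t => α t s q) l (𝓝 (α' s q)) := fun s q =>
    tendsto_pi_nhds.1 (tendsto_pi_nhds.1 hα s) q
  have hbe : ∀ s, Tendsto (fun t => b t s - b t k) l (𝓝 (b' s - b' k)) := fun s =>
    (tendsto_pi_nhds.1 hb s).sub (tendsto_pi_nhds.1 hb k)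
  have hDb : ∀ s i, Tendsto (fun t => (D t s *ᵥ (b t s - b t k)) i) l
      (𝓝 ((D' s *ᵥ (b' s - b' k)) i)) := fun s i =>
    tendsto_pi_nhds.1 (tendsto_mulVec (tendsto_pi_nhds.1 hD s) (hbe s)) i
  refine tendsto_pi_nhds.2 fun i => tendsto_pi_nhds.2 fun r => ?_
  simp only [sigmaMatrix_apply]
  refine Tendsto.sub (tendsto_finsetSum _ fun s _ => ?_)
    (tendsto_finsetSum _ fun s _ => tendsto_finsetSum _ fun m _ => ?_)
  · exact (tendsto_finsetSum _ fun q _ => hαe s q).mul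
      (((hDe s i r).mul (tendsto_pi_nhds.1 hσ s)).add
        (tendsto_dotProduct (hbe s) (tendsto_mulVec (hLe s i r) (hbe s))))
  · exact (hαe s m).mul ((hDb s i).mul (hDb m r))

end Continuity

/-! ### Consistency of the estimators -/

namespace IsRegressionMixture

variable {M d : ℕ} {FX : Fin M → Measure (Fin d → ℝ)} {Fe : Fin M → Measure ℝ}
  {Ω : Type*} [MeasurableSpace Ω] {μ : Measure Ω}
  {p : ℕ → Fin M → ℝ} {b : Fin M → Fin d → ℝ}
  {κ : ℕ → Ω → Fin M} {X : ℕ → Ω → Fin d → ℝ} {ε : ℕ → Ω → ℝ} {Y : ℕ → Ω → ℝ}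

lemma residual_subject (h : IsRegressionMixture μ p b FX Fe κ X ε Y) (β : Fin d → ℝ) (j : ℕ)
    (ω : Ω) : residual b β (κ j ω, X j ω, ε j ω) = Y j ω - β ⬝ᵥ X j ω := by
  rw [residual, h.response]

variable [IsProbabilityMeasure μ] [∀ m, IsProbabilityMeasure (FX m)] [∀ m, IsProbabilityMeasure (Fe m)]

/-- By biorthogonality of the weights, the expectation of the average equals the limit exactly once
Γ_n is nonsingular; the weak law handles the fluctuation. -/
lemma tendsto_average (h : IsRegressionMixture μ p b FX Fe κ X ε Y)
    (hΓ : ∃ C : ℝ, 0 < C ∧ ∀ᶠ n in atTop, C < (gramMatrix p n).det)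
    {f : Fin M × (Fin d → ℝ) × ℝ → ℝ} (hfm : Measurable f)
    (hf : ∀ m, Integrable f (componentLaw FX Fe m)) (m : Fin M) :
    Tendsto (fun q : ℕ × Ω => (1 / (q.1 : ℝ)) * ∑ j ∈ Finset.range q.1,
      weight p m q.1 j * f (κ j q.2, X j q.2, ε j q.2)) (probFilter μ)
      (𝓝 (∫ o, f o ∂(componentLaw FX Fe m))) := by
  obtain ⟨W, hW⟩ := exists_abs_weight_le h.prob_nonneg h.prob_le_one hΓ m
  refine tendsto_weighted_average h.measurable_subject h.indep_subjects h.map_subject_le hfm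
    (integrable_finsetSum_measure.2 fun m _ => hf m) hW ?_
  obtain ⟨C, hC, hdet⟩ := hΓ
  filter_upwards [hdet] with n hn
  simp_rw [h.integral_subject hf, Finset.mul_sum]
  rw [Finset.sum_comm]
  have : ∀ s, ∑ j ∈ Finset.range n, 1 / (n : ℝ) * (weight p m n j *
      (p j s * ∫ o, f o ∂(componentLaw FX Fe s)))
      = (if m = s then 1 else 0) * ∫ o, f o ∂(componentLaw FX Fe s) := fun s => by
    rw [← average_weight_mul_prob (hC.trans hn).ne' m s, Finset.mul_sum, Finset.sum_mul]
    exact Finset.sum_congr rfl fun j _ => by ring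
  simp_rw [this]
  simp

theorem tendsto_secondMomentHat (h : IsRegressionMixture μ p b FX Fe κ X ε Y)
    (hX4 : ∀ m i, Integrable (fun x : Fin d → ℝ => x i ^ 4) (FX m))
    (hΓ : ∃ C : ℝ, 0 < C ∧ ∀ᶠ n in atTop, C < (gramMatrix p n).det) (m : Fin M) :
    Tendsto (fun q : ℕ × Ω => secondMomentHat p (fun j => X j q.2) q.1 m) (probFilter μ)
      (𝓝 (secondMoment (FX m))) := by
  refine tendsto_pi_nhds.2 fun i => tendsto_pi_nhds.2 fun s => ?_
  have := h.tendsto_average hΓ (f := fun o => o.2.1 i * o.2.1 s) (by fun_prop)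
    (fun m => (memLp_two_mul (memLp_four_regressor hX4 m i)
      (memLp_four_regressor hX4 m s)).integrable (by norm_num)) m
  rw [integral_regressor_mul] at this
  simpa only [secondMomentHat, Matrix.of_apply, mul_assoc] using this

theorem tendsto_fourthMomentHat (h : IsRegressionMixture μ p b FX Fe κ X ε Y)
    (hX4 : ∀ m i, Integrable (fun x : Fin d → ℝ => x i ^ 4) (FX m))
    (hΓ : ∃ C : ℝ, 0 < C ∧ ∀ᶠ n in atTop, C < (gramMatrix p n).det) (m : Fin M) (i s : Fin d) :
    Tendsto (fun q : ℕ × Ω => fourthMomentHat p (fun j => X j q.2) q.1 m i s) (probFilter μ)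
      (𝓝 (fourthMoment (FX m) i s)) := by
  refine tendsto_pi_nhds.2 fun l => tendsto_pi_nhds.2 fun r => ?_
  have := h.tendsto_average hΓ (f := fun o => o.2.1 i * o.2.1 s * (o.2.1 l * o.2.1 r))
    (by fun_prop)
    (fun m => integrable_mul_of_memLp_two
      (memLp_two_mul (memLp_four_regressor hX4 m i) (memLp_four_regressor hX4 m s))
      (memLp_two_mul (memLp_four_regressor hX4 m l) (memLp_four_regressor hX4 m r))) m
  rw [integral_regressor_mul_four] at this
  simpa only [fourthMomentHat, Matrix.of_apply, mul_assoc] using this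

lemma tendsto_average_regressor_mul_response (h : IsRegressionMixture μ p b FX Fe κ X ε Y)
    (hX4 : ∀ m i, Integrable (fun x : Fin d → ℝ => x i ^ 4) (FX m))
    (he4 : ∀ m, Integrable (fun e : ℝ => e ^ 4) (Fe m))
    (hΓ : ∃ C : ℝ, 0 < C ∧ ∀ᶠ n in atTop, C < (gramMatrix p n).det) (m : Fin M) :
    Tendsto (fun (q : ℕ × Ω) i => (1 / (q.1 : ℝ)) * ∑ j ∈ Finset.range q.1,
      weight p m q.1 j * (X j q.2 i * Y j q.2)) (probFilter μ)
      (𝓝 (secondMoment (FX m) *ᵥ b m)) := by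
  refine tendsto_pi_nhds.2 fun i => ?_
  have := h.tendsto_average hΓ (f := fun o => o.2.1 i * residual b 0 o) (by fun_prop)
    (fun m => (memLp_two_mul (memLp_four_regressor hX4 m i)
      (memLp_four_residual hX4 he4 b 0 m)).integrable (by norm_num)) m
  rw [integral_regressor_mul_residual (hX4 m) (he4 m) (h.error_mean m)] at this
  simpa only [h.residual_subject, zero_dotProduct, sub_zero] using this

lemma tendsto_average_response_sq (h : IsRegressionMixture μ p b FX Fe κ X ε Y)
    (hX4 : ∀ m i, Integrable (fun x : Fin d → ℝ => x i ^ 4) (FX m))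
    (he4 : ∀ m, Integrable (fun e : ℝ => e ^ 4) (Fe m))
    (hΓ : ∃ C : ℝ, 0 < C ∧ ∀ᶠ n in atTop, C < (gramMatrix p n).det) (m : Fin M) :
    Tendsto (fun (q : ℕ × Ω) => (1 / (q.1 : ℝ)) * ∑ j ∈ Finset.range q.1,
      weight p m q.1 j * Y j q.2 ^ 2) (probFilter μ)
      (𝓝 (b m ⬝ᵥ (secondMoment (FX m) *ᵥ b m) + variance id (Fe m))) := by
  have := h.tendsto_average hΓ (f := fun o => residual b 0 o ^ 2) (by fun_prop)
    (fun m => ((memLp_four_residual hX4 he4 b 0 m).mono_exponent (by norm_num)).integrable_sq) m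
  rw [integral_residual_sq (hX4 m) (he4 m) (h.error_mean m)] at this
  simpa only [h.residual_subject, zero_dotProduct, sub_zero] using this

/-- The determinant is continuous and nonzero at the limit. The formulas for the estimator hold only
on this event, the inverse being a default value elsewhere. -/
lemma eventually_det_secondMomentHat_ne_zero (h : IsRegressionMixture μ p b FX Fe κ X ε Y)
    (hX4 : ∀ m i, Integrable (fun x : Fin d → ℝ => x i ^ 4) (FX m))
    (hΓ : ∃ C : ℝ, 0 < C ∧ ∀ᶠ n in atTop, C < (gramMatrix p n).det) {m : Fin M}
    (hD : (secondMoment (FX m)).det ≠ 0) :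
    ∀ᶠ q : ℕ × Ω in probFilter μ,
      q.1 ≠ 0 ∧ (secondMomentHat p (fun j => X j q.2) q.1 m).det ≠ 0 := by
  have h1 := ((continuous_id.matrix_det.tendsto _).comp
    (h.tendsto_secondMomentHat hX4 hΓ m)).eventually_ne hD
  filter_upwards [h1, tendsto_fst_probFilter.eventually (eventually_ne_atTop 0)] with q hq hq0
  exact ⟨hq0, hq⟩

theorem tendsto_lsEstimator (h : IsRegressionMixture μ p b FX Fe κ X ε Y)
    (hX4 : ∀ m i, Integrable (fun x : Fin d → ℝ => x i ^ 4) (FX m))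
    (he4 : ∀ m, Integrable (fun e : ℝ => e ^ 4) (Fe m))
    (hΓ : ∃ C : ℝ, 0 < C ∧ ∀ᶠ n in atTop, C < (gramMatrix p n).det) {m : Fin M}
    (hD : (secondMoment (FX m)).det ≠ 0) :
    Tendsto (fun q : ℕ × Ω => lsEstimator p (fun j => X j q.2) (fun j => Y j q.2) m q.1)
      (probFilter μ) (𝓝 (b m)) := by
  have hlim := tendsto_mulVec (tendsto_matrix_inv (h.tendsto_secondMomentHat hX4 hΓ m) hD)
    (h.tendsto_average_regressor_mul_response hX4 he4 hΓ m)
  rw [Matrix.mulVec_mulVec, Matrix.nonsing_inv_mul _ (isUnit_iff_ne_zero.2 hD),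
    Matrix.one_mulVec] at hlim
  refine hlim.congr' ?_
  filter_upwards [h.eventually_det_secondMomentHat_ne_zero hX4 hΓ hD] with q hq
  rw [lsEstimator_eq hq.1 hq.2]

theorem tendsto_errorVarHat (h : IsRegressionMixture μ p b FX Fe κ X ε Y)
    (hX4 : ∀ m i, Integrable (fun x : Fin d → ℝ => x i ^ 4) (FX m))
    (he4 : ∀ m, Integrable (fun e : ℝ => e ^ 4) (Fe m))
    (hΓ : ∃ C : ℝ, 0 < C ∧ ∀ᶠ n in atTop, C < (gramMatrix p n).det) {m : Fin M}
    (hD : (secondMoment (FX m)).det ≠ 0) :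
    Tendsto (fun q : ℕ × Ω => errorVarHat p (fun j => X j q.2) (fun j => Y j q.2) q.1 m)
      (probFilter μ) (𝓝 (variance id (Fe m))) := by
  simp_rw [errorVarHat_eq]
  have hb := h.tendsto_lsEstimator hX4 he4 hΓ hD
  have hlim := ((h.tendsto_average_response_sq hX4 he4 hΓ m).sub
    ((tendsto_dotProduct hb
      (h.tendsto_average_regressor_mul_response hX4 he4 hΓ m)).const_mul 2)).add
    (tendsto_dotProduct hb (tendsto_mulVec (h.tendsto_secondMomentHat hX4 hΓ m) hb))
  -- With c = b m ⬝ᵥ (D *ᵥ b m), the limit is (c + σ²) - 2c + c.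
  convert hlim using 2
  ring

theorem tendsto_dispersionHat (h : IsRegressionMixture μ p b FX Fe κ X ε Y)
    (hX4 : ∀ m i, Integrable (fun x : Fin d → ℝ => x i ^ 4) (FX m))
    (he4 : ∀ m, Integrable (fun e : ℝ => e ^ 4) (Fe m))
    (hΓ : ∃ C : ℝ, 0 < C ∧ ∀ᶠ n in atTop, C < (gramMatrix p n).det)
    (hD : ∀ m, (secondMoment (FX m)).det ≠ 0) {k : Fin M} {αlim : Fin M → Fin M → ℝ}
    (hαlim : ∀ s q, Tendsto (fun n => alphaHat p k n s q) atTop (𝓝 (αlim s q))) :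
    Tendsto (fun q : ℕ × Ω => dispersionHat p (fun j => X j q.2) (fun j => Y j q.2) k q.1)
      (probFilter μ) (𝓝 (dispersion k αlim (fun m => secondMoment (FX m))
        (fun m => fourthMoment (FX m)) b (fun m => variance id (Fe m)))) := by
  have hinv := tendsto_matrix_inv (h.tendsto_secondMomentHat hX4 hΓ k) (hD k)
  have hσ := tendsto_sigmaMatrix k
    (tendsto_pi_nhds.2 fun s => tendsto_pi_nhds.2 fun q =>
      (hαlim s q).comp (tendsto_fst_probFilter (μ := μ)))
    (tendsto_pi_nhds.2 fun m => h.tendsto_secondMomentHat hX4 hΓ m)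
    (tendsto_pi_nhds.2 fun m => tendsto_pi_nhds.2 fun i => tendsto_pi_nhds.2 fun s =>
      h.tendsto_fourthMomentHat hX4 hΓ m i s)
    (tendsto_pi_nhds.2 fun m => h.tendsto_lsEstimator hX4 he4 hΓ (hD m))
    (tendsto_pi_nhds.2 fun m => h.tendsto_errorVarHat hX4 he4 hΓ (hD m))
  exact (hinv.mul hσ).mul hinv

end IsRegressionMixture

/-! ### Asymptotic normality of the normalized score -/

/-- The `i`-th component `X^i (Y - Xᵀ β)` of the score. -/
def score {M d : ℕ} (b : Fin M → Fin d → ℝ) (β : Fin d → ℝ) (i : Fin d)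
    (o : Fin M × (Fin d → ℝ) × ℝ) : ℝ :=
  o.2.1 i * residual b β o

@[fun_prop]
lemma measurable_score {M d : ℕ} (b : Fin M → Fin d → ℝ) (β : Fin d → ℝ) (i : Fin d) :
    Measurable (score b β i) := by
  unfold score; fun_prop

/-- The normalized weighted sum of the scores at `β`. -/
noncomputable def scoreSum {M d : ℕ} (p : ℕ → Fin M → ℝ) (x : ℕ → Fin d → ℝ) (y : ℕ → ℝ)
    (k : Fin M) (β : Fin d → ℝ) (n : ℕ) : Fin d → ℝ :=
  fun i => (√(n : ℝ))⁻¹ * ∑ j ∈ Finset.range n, weight p k n j * (x j i * (y j - β ⬝ᵥ x j))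

/-- The covariance of a mixture is the mixed second moment minus the product of the mixed means. The
second moment carries a single factor p j s, and Σ_q p j q = 1 provides the other one; hence the row
sums of `alphaHat`. The product of means carries two factors already. -/
lemma average_sq_weight_mul_cov {M : ℕ} {p : ℕ → Fin M → ℝ} (hp : ∀ j, ∑ m, p j m = 1)
    (k : Fin M) (n : ℕ) (w u v : Fin M → ℝ) :
    (1 / (n : ℝ)) * ∑ j ∈ Finset.range n, weight p k n j ^ 2 *
      ((∑ s, p j s * w s) - (∑ s, p j s * u s) * ∑ s, p j s * v s)
      = (∑ s, (∑ q, alphaHat p k n s q) * w s) - ∑ s, ∑ m, alphaHat p k n s m * (u s * v m) := by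
  have h1 : ∀ s, ∑ q, alphaHat p k n s q
      = (1 / (n : ℝ)) * ∑ j ∈ Finset.range n, weight p k n j ^ 2 * p j s := by
    intro s
    simp only [alphaHat]
    rw [← Finset.mul_sum, Finset.sum_comm]
    congr 1
    exact Finset.sum_congr rfl fun j _ => by rw [← Finset.mul_sum, hp, mul_one]
  simp_rw [h1, alphaHat, Finset.sum_mul_sum]
  simp only [mul_sub, Finset.sum_sub_distrib, Finset.mul_sum, Finset.sum_mul]
  congr 1
  · rw [Finset.sum_comm]
    exact Finset.sum_congr rfl fun s _ => Finset.sum_congr rfl fun j _ => by ring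
  · rw [Finset.sum_comm]
    refine Finset.sum_congr rfl fun s _ => ?_
    rw [Finset.sum_comm]
    exact Finset.sum_congr rfl fun m _ => Finset.sum_congr rfl fun j _ => by ring

lemma average_quadraticForm {d : ℕ} (a : ℝ) (r : Finset ℕ) (w : ℕ → ℝ)
    (c : ℕ → Fin d → Fin d → ℝ) (t : Fin d → ℝ) :
    a * ∑ j ∈ r, w j * ∑ i, ∑ l, t i * t l * c j i l
      = t ⬝ᵥ ((Matrix.of fun i l => a * ∑ j ∈ r, w j * c j i l) *ᵥ t) := by
  simp only [dotProduct, Matrix.mulVec, Matrix.of_apply, Finset.mul_sum, Finset.sum_mul]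
  rw [Finset.sum_comm]
  refine Finset.sum_congr rfl fun i _ => ?_
  rw [Finset.sum_comm]
  exact Finset.sum_congr rfl fun l _ => Finset.sum_congr rfl fun j _ => by ring

namespace IsRegressionMixture

variable {M d : ℕ} {FX : Fin M → Measure (Fin d → ℝ)} {Fe : Fin M → Measure ℝ}
  {Ω : Type*} [MeasurableSpace Ω] {μ : Measure Ω}
  {p : ℕ → Fin M → ℝ} {b : Fin M → Fin d → ℝ}
  {κ : ℕ → Ω → Fin M} {X : ℕ → Ω → Fin d → ℝ} {ε : ℕ → Ω → ℝ} {Y : ℕ → Ω → ℝ}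

lemma measurable_response (h : IsRegressionMixture μ p b FX Fe κ X ε Y) (j : ℕ) :
    Measurable (Y j) := by
  have : Y j = fun ω => residual b 0 (κ j ω, X j ω, ε j ω) := by
    ext ω
    rw [h.residual_subject, zero_dotProduct, sub_zero]
  rw [this]
  exact (measurable_residual b 0).comp (h.measurable_subject j)

lemma measurable_scoreSum (h : IsRegressionMixture μ p b FX Fe κ X ε Y) (k : Fin M)
    (β : Fin d → ℝ) (n : ℕ) :
    Measurable fun ω => scoreSum p (fun j => X j ω) (fun j => Y j ω) k β n := by
  have hY := h.measurable_response
  have hX := h.measurable_regressors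
  have hXe : ∀ j i, Measurable fun ω => X j ω i := fun j i => (measurable_pi_apply i).comp (hX j)
  unfold scoreSum dotProduct
  fun_prop

lemma measurable_toLp_scoreSum (h : IsRegressionMixture μ p b FX Fe κ X ε Y) (k : Fin M)
    (β : Fin d → ℝ) (n : ℕ) : Measurable fun ω =>
      (WithLp.toLp 2 (scoreSum p (fun j => X j ω) (fun j => Y j ω) k β n) :
        EuclideanSpace ℝ (Fin d)) :=
  (WithLp.measurable_toLp 2 _).comp (h.measurable_scoreSum k β n)

variable [IsProbabilityMeasure μ] [∀ m, IsProbabilityMeasure (FX m)] [∀ m, IsProbabilityMeasure (Fe m)]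

lemma average_sq_weight_mul_variance (h : IsRegressionMixture μ p b FX Fe κ X ε Y)
    (hX4 : ∀ m i, Integrable (fun x : Fin d → ℝ => x i ^ 4) (FX m))
    (he4 : ∀ m, Integrable (fun e : ℝ => e ^ 4) (Fe m)) (k : Fin M) (n : ℕ) (t : Fin d → ℝ) :
    (1 / (n : ℝ)) * ∑ j ∈ Finset.range n, weight p k n j ^ 2 *
      Var[fun ω => ∑ i, t i * score b (b k) i (κ j ω, X j ω, ε j ω); μ]
      = t ⬝ᵥ (sigmaMatrix k (alphaHat p k n) (fun m => secondMoment (FX m))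
        (fun m => fourthMoment (FX m)) b (fun m => variance id (Fe m)) *ᵥ t) := by
  have hL2 : ∀ m i, MemLp (score b (b k) i) 2 (componentLaw FX Fe m) := fun m i =>
    memLp_two_mul (memLp_four_regressor hX4 m i) (memLp_four_residual hX4 he4 b (b k) m)
  have hO := fun i => memLp_comp_of_map_le h.measurable_subject h.map_subject_le
    (memLp_two_sum (by fun_prop) fun m => hL2 m i)
  have hvar : ∀ j, Var[fun ω => ∑ i, t i * score b (b k) i (κ j ω, X j ω, ε j ω); μ]
      = ∑ i, ∑ l, t i * t l * ((∑ s, p j s * (secondMoment (FX s) i l * variance id (Fe s)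
        + (b s - b k) ⬝ᵥ (fourthMoment (FX s) i l *ᵥ (b s - b k))))
        - (∑ s, p j s * (secondMoment (FX s) *ᵥ (b s - b k)) i)
          * ∑ s, p j s * (secondMoment (FX s) *ᵥ (b s - b k)) l) := by
    intro j
    rw [variance_fun_sum fun i => (hO i j).const_mul (t i)]
    refine Finset.sum_congr rfl fun i _ => Finset.sum_congr rfl fun l _ => ?_
    rw [covariance_const_mul_left, covariance_const_mul_right, covariance_eq_sub (hO i j) (hO l j),
      ← mul_assoc]
    congr 1
    have h1 : ∀ i, ∫ ω, score b (b k) i (κ j ω, X j ω, ε j ω) ∂μ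
        = ∑ s, p j s * (secondMoment (FX s) *ᵥ (b s - b k)) i := fun i => by
      rw [h.integral_subject fun m => (hL2 m i).integrable (by norm_num)]
      refine Finset.sum_congr rfl fun s _ => ?_
      rw [← integral_regressor_mul_residual (hX4 s) (he4 s) (h.error_mean s)]
      rfl
    rw [h1, h1]
    congr 1
    have h2 := h.integral_subject (f := fun o => score b (b k) i o * score b (b k) l o)
      (fun m => integrable_mul_of_memLp_two (hL2 m i) (hL2 m l)) j
    simp only [Pi.mul_apply]
    rw [h2]
    refine Finset.sum_congr rfl fun s _ => ?_
    rw [← integral_score_mul_score (hX4 s) (he4 s) (h.error_mean s)]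
    rfl
  simp_rw [hvar]
  rw [average_quadraticForm]
  congr 2
  refine Matrix.ext fun i l => ?_
  rw [sigmaMatrix_apply, Matrix.of_apply]
  exact average_sq_weight_mul_cov h.sum_prob k n _ _ _

/-- The quadratic form is a limit of weighted averages of variances. Semidefiniteness is what makes
Σ the covariance matrix of the limiting `multivariateGaussian`. -/
lemma posSemidef_sigmaMatrix (h : IsRegressionMixture μ p b FX Fe κ X ε Y)
    (hX4 : ∀ m i, Integrable (fun x : Fin d → ℝ => x i ^ 4) (FX m))
    (he4 : ∀ m, Integrable (fun e : ℝ => e ^ 4) (Fe m)) {k : Fin M} {αlim : Fin M → Fin M → ℝ}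
    (hαlim : ∀ s q, Tendsto (fun n => alphaHat p k n s q) atTop (𝓝 (αlim s q))) :
    (sigmaMatrix k αlim (fun m => secondMoment (FX m)) (fun m => fourthMoment (FX m)) b
      (fun m => variance id (Fe m))).PosSemidef := by
  refine Matrix.PosSemidef.of_dotProduct_mulVec_nonneg ?_ fun t => ?_
  · have hα : ∀ s q, αlim s q = αlim q s := fun s q => by
      refine tendsto_nhds_unique (hαlim s q) ((hαlim q s).congr fun n => ?_)
      simp only [alphaHat]
      congr 1
      exact Finset.sum_congr rfl fun j _ => by ring
    have hD : ∀ s i l, secondMoment (FX s) i l = secondMoment (FX s) l i := fun s i l => by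
      simp only [secondMoment, Matrix.of_apply, mul_comm]
    have hL : ∀ s i l, fourthMoment (FX s) i l = fourthMoment (FX s) l i := fun s i l => by
      ext q r
      simp only [fourthMoment, Matrix.of_apply]
      exact integral_congr_ae (.of_forall fun x => by simp only; ring)
    refine Matrix.IsHermitian.ext fun i l => ?_
    rw [star_trivial, sigmaMatrix_apply, sigmaMatrix_apply]
    congr 1
    · exact Finset.sum_congr rfl fun s _ => by rw [hD s l i, hL s l i]
    · rw [Finset.sum_comm]
      exact Finset.sum_congr rfl fun s _ => Finset.sum_congr rfl fun m _ => by
        rw [hα m s]; ring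
  · rw [star_trivial]
    have hlim := tendsto_dotProduct tendsto_const_nhds (tendsto_mulVec (tendsto_sigmaMatrix k
      (tendsto_pi_nhds.2 fun s => tendsto_pi_nhds.2 fun q => hαlim s q)
      (tendsto_const_nhds (x := fun m => secondMoment (FX m)))
      (tendsto_const_nhds (x := fun m => fourthMoment (FX m))) (tendsto_const_nhds (x := b))
      (tendsto_const_nhds (x := fun m => variance id (Fe m)))) (tendsto_const_nhds (x := t)))
      (u := fun _ => t)
    refine ge_of_tendsto' hlim fun n => ?_
    rw [← h.average_sq_weight_mul_variance hX4 he4 k n t]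
    exact mul_nonneg (by positivity)
      (Finset.sum_nonneg fun j _ => mul_nonneg (sq_nonneg _) (variance_nonneg _ _))

/-- Subjects from other components bias the individual scores, but the weights retain only the mean
within component k, which is zero at b k. -/
lemma sum_weight_mul_integral_score (h : IsRegressionMixture μ p b FX Fe κ X ε Y)
    (hX4 : ∀ m i, Integrable (fun x : Fin d → ℝ => x i ^ 4) (FX m))
    (he4 : ∀ m, Integrable (fun e : ℝ => e ^ 4) (Fe m)) (k : Fin M) {n : ℕ} (hn0 : n ≠ 0)
    (hn : (gramMatrix p n).det ≠ 0) (t : Fin d → ℝ) :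
    ∑ j ∈ Finset.range n, weight p k n j *
      ∫ ω, ∑ i, t i * score b (b k) i (κ j ω, X j ω, ε j ω) ∂μ = 0 := by
  have hL2 : ∀ m i, MemLp (score b (b k) i) 2 (componentLaw FX Fe m) := fun m i =>
    memLp_two_mul (memLp_four_regressor hX4 m i) (memLp_four_residual hX4 he4 b (b k) m)
  have hi : ∀ m i, Integrable (fun o => t i * score b (b k) i o) (componentLaw FX Fe m) :=
    fun m i => ((hL2 m i).integrable (by norm_num)).const_mul _
  have hf : ∀ m, Integrable (fun o => ∑ i, t i * score b (b k) i o) (componentLaw FX Fe m) :=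
    fun m => integrable_finsetSum _ fun i _ => hi m i
  set e : Fin M → ℝ := fun s => ∫ o, ∑ i, t i * score b (b k) i o ∂(componentLaw FX Fe s) with he
  have hek : e k = 0 := by
    rw [he]
    simp only
    rw [integral_finsetSum _ fun i _ => hi k i]
    refine Finset.sum_eq_zero fun i _ => ?_
    rw [integral_const_mul]
    have := integral_regressor_mul_residual (hX4 k) (he4 k) (h.error_mean k) b (b k) i
    rw [sub_self, Matrix.mulVec_zero] at this
    rw [show ∫ o, score b (b k) i o ∂(componentLaw FX Fe k) = 0 from this, mul_zero]
  have h1 : (1 / (n : ℝ)) * ∑ j ∈ Finset.range n, weight p k n j *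
      ∫ ω, ∑ i, t i * score b (b k) i (κ j ω, X j ω, ε j ω) ∂μ
      = ∑ s, (if k = s then 1 else 0) * e s := by
    simp_rw [← average_weight_mul_prob hn, h.integral_subject hf, Finset.mul_sum, Finset.sum_mul]
    rw [Finset.sum_comm]
    exact Finset.sum_congr rfl fun s _ => Finset.sum_congr rfl fun j _ => by simp only [he]; ring
  have h2 : ∑ s, (if k = s then 1 else 0) * e s = 0 := by simp [hek]
  rw [h2] at h1
  exact (mul_eq_zero.1 h1).resolve_left (one_div_ne_zero (Nat.cast_ne_zero.2 hn0))

/-- Asymptotic normality of the normalized weighted sum of the scores. -/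
theorem tendstoInDistribution_scoreSum (h : IsRegressionMixture μ p b FX Fe κ X ε Y)
    (hX4 : ∀ m i, Integrable (fun x : Fin d → ℝ => x i ^ 4) (FX m))
    (he4 : ∀ m, Integrable (fun e : ℝ => e ^ 4) (Fe m))
    (hΓ : ∃ C : ℝ, 0 < C ∧ ∀ᶠ n in atTop, C < (gramMatrix p n).det) {k : Fin M}
    {αlim : Fin M → Fin M → ℝ}
    (hαlim : ∀ s q, Tendsto (fun n => alphaHat p k n s q) atTop (𝓝 (αlim s q))) :
    TendstoInDistribution (fun n ω => WithLp.toLp 2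
        (scoreSum p (fun j => X j ω) (fun j => Y j ω) k (b k) n)) atTop
      (id : EuclideanSpace ℝ (Fin d) → EuclideanSpace ℝ (Fin d)) (fun _ => μ)
      (multivariateGaussian 0 (sigmaMatrix k αlim (fun m => secondMoment (FX m))
        (fun m => fourthMoment (FX m)) b (fun m => variance id (Fe m)))) where
  forall_aemeasurable n :=
    (h.measurable_toLp_scoreSum k (b k) n).aemeasurable
  tendsto := by
    -- Lévy's continuity theorem with the Cramér–Wold reduction: at t, the characteristic function
    -- is that of the scalar combination with coefficients t, taken at frequency 1.
    refine ProbabilityMeasure.tendsto_iff_tendsto_charFun.2 fun t => ?_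
    simp only [ProbabilityMeasure.coe_mk, Measure.map_id]
    rw [charFun_multivariateGaussian (h.posSemidef_sigmaMatrix hX4 he4 hαlim)]
    have hL2 : ∀ m i, MemLp (score b (b k) i) 2 (componentLaw FX Fe m) := fun m i =>
      memLp_two_mul (memLp_four_regressor hX4 m i) (memLp_four_residual hX4 he4 b (b k) m)
    obtain ⟨W, hW⟩ := exists_abs_weight_le h.prob_nonneg h.prob_le_one hΓ k
    have hsig := tendsto_sigmaMatrix k
      (tendsto_pi_nhds.2 fun s => tendsto_pi_nhds.2 fun q => hαlim s q)
      (tendsto_const_nhds (x := fun m => secondMoment (FX m)))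
      (tendsto_const_nhds (x := fun m => fourthMoment (FX m))) (tendsto_const_nhds (x := b))
      (tendsto_const_nhds (x := fun m => variance id (Fe m)))
    have hclt := tendsto_integral_cexp_weighted_sum h.measurable_subject h.indep_subjects
      h.map_subject_le (f := fun o => ∑ i, t i * score b (b k) i o) (by fun_prop)
      (memLp_two_sum (by fun_prop) fun m => memLp_finsetSum _ fun i _ => (hL2 m i).const_mul (t i))
      hW (v := t ⬝ᵥ (sigmaMatrix k αlim (fun m => secondMoment (FX m))
        (fun m => fourthMoment (FX m)) b (fun m => variance id (Fe m)) *ᵥ t))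
      (by
        simp_rw [h.average_sq_weight_mul_variance hX4 he4 k _ t]
        exact tendsto_dotProduct tendsto_const_nhds (tendsto_mulVec hsig tendsto_const_nhds))
    have hlim : Complex.exp (-((t ⬝ᵥ (sigmaMatrix k αlim (fun m => secondMoment (FX m))
        (fun m => fourthMoment (FX m)) b (fun m => variance id (Fe m)) *ᵥ t) : ℝ) : ℂ) / 2)
        = Complex.exp ((inner ℝ t (0 : EuclideanSpace ℝ (Fin d)) : ℝ) * Complex.I -
          (t ⬝ᵥ (sigmaMatrix k αlim (fun m => secondMoment (FX m))
        (fun m => fourthMoment (FX m)) b (fun m => variance id (Fe m)) *ᵥ t) : ℝ) / 2) := by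
      rw [inner_zero_right]; congr 1; push_cast; ring
    rw [← hlim]
    -- The scalar theorem centers each summand; the centerings add up to zero for all large n.
    refine hclt.congr' ?_
    obtain ⟨C, hC, hdet⟩ := hΓ
    filter_upwards [hdet, eventually_ne_atTop 0] with n hn hn0
    rw [charFun_apply, integral_map
      (h.measurable_toLp_scoreSum k (b k) n).aemeasurable
      (by fun_prop)]
    refine integral_congr_ae (.of_forall fun ω => ?_)
    simp only
    congr 3
    rw [Finset.sum_sub_distrib, h.sum_weight_mul_integral_score hX4 he4 k hn0 (hC.trans hn).ne',
      sub_zero]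
    simp only [PiLp.inner_apply, scoreSum, score, h.residual_subject, Finset.mul_sum]
    rw [Finset.sum_comm]
    refine Finset.sum_congr rfl fun i _ => ?_
    simp only [RCLike.inner_apply, conj_trivial, Finset.mul_sum]
    exact Finset.sum_congr rfl fun j _ => by ring

end IsRegressionMixture

/-! ### The `χ²` distribution and its quantiles -/

section ChiSq

lemma measurable_sum_sq (d : ℕ) : Measurable fun z : Fin d → ℝ => ∑ i, z i ^ 2 := by fun_prop

instance isProbabilityMeasure_chiSq (d : ℕ) : IsProbabilityMeasure (chiSq d) :=
  Measure.isProbabilityMeasure_map (measurable_sum_sq d).aemeasurable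

lemma nullSet_sq_eq (c : ℝ) : gaussianReal 0 1 {z : ℝ | z ^ 2 = c} = 0 := by
  have : NullSingletonClass (gaussianReal 0 1) := nullSingletonClass_gaussianReal one_ne_zero
  have hsub : {z : ℝ | z ^ 2 = c} ⊆ {√c, -√c} := by
    intro z hz
    have hz' : z ^ 2 = c := hz
    have hc : 0 ≤ c := hz' ▸ sq_nonneg z
    rw [← Real.sq_sqrt hc] at hz'
    exact sq_eq_sq_iff_eq_or_eq_neg.1 hz'
  exact measure_mono_null hsub (Set.Finite.measure_zero (Set.toFinite _) _)

/-- Fubini: with the other coordinates fixed, the first one must solve z² = const, which leaves at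
most two points. For d = 0 the law is the point mass at 0, so d ≥ 1 matters. -/
lemma nullSingletonClass_chiSq {d : ℕ} (hd : 1 ≤ d) : NullSingletonClass (chiSq d) := by
  obtain ⟨d, rfl⟩ := Nat.exists_eq_add_of_le' hd
  refine ⟨fun c => ?_⟩
  rw [chiSq, Measure.map_apply (measurable_sum_sq _) (measurableSet_singleton c)]
  have hmp := (measurePreserving_piFinSuccAbove (fun _ : Fin (d + 1) => gaussianReal 0 1) 0).symm
  have hms : MeasurableSet ((fun z : Fin (d + 1) → ℝ => ∑ i, z i ^ 2) ⁻¹' {c}) :=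
    measurable_sum_sq _ (measurableSet_singleton c)
  rw [← hmp.measure_preimage hms.nullMeasurableSet,
    Measure.prod_apply_symm (hmp.measurable hms), lintegral_eq_zero_of_ae_eq_zero]
  refine .of_forall fun w => measure_mono_null (fun z hz => ?_)
    (nullSet_sq_eq (c - ∑ i, w i ^ 2))
  have hz' : z ^ 2 + ∑ i, w i ^ 2 = c := by
    simpa [Fin.sum_univ_succ, MeasurableEquiv.piFinSuccAbove_symm_apply, Fin.insertNthEquiv] using hz
  exact eq_sub_of_add_eq hz'

lemma continuous_measureReal_Iic (ν : Measure ℝ) [IsProbabilityMeasure ν] [NullSingletonClass ν] :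
    Continuous fun t => ν.real (Set.Iic t) := by
  simp_rw [← cdf_eq_real]
  rw [continuous_iff_continuousAt]
  intro t
  rw [(monotone_cdf ν).continuousAt_iff_leftLim_eq_rightLim, StieltjesFunction.rightLim_eq]
  have h := (cdf ν).measure_singleton t
  rw [measure_cdf, measure_singleton] at h
  have h1 := ENNReal.ofReal_eq_zero.1 h.symm
  exact le_antisymm ((monotone_cdf ν).leftLim_le le_rfl) (by linarith)

/-- Without atoms the distribution function is continuous, so the level u is taken exactly and the
infimum defining the quantile is attained. -/
lemma measureReal_Iic_quantile (ν : Measure ℝ) [IsProbabilityMeasure ν] [NullSingletonClass ν] {u : ℝ}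
    (hu0 : 0 < u) (hu1 : u < 1) : ν.real (Set.Iic (quantile ν u)) = u := by
  have hcont := continuous_measureReal_Iic ν
  have hbot : Tendsto (fun t => ν.real (Set.Iic t)) atBot (𝓝 0) := by
    simpa only [← cdf_eq_real] using tendsto_cdf_atBot ν
  have htop : Tendsto (fun t => ν.real (Set.Iic t)) atTop (𝓝 1) := by
    simpa only [← cdf_eq_real] using tendsto_cdf_atTop ν
  have hmono : Monotone fun t => ν.real (Set.Iic t) := fun s t hst =>
    measureReal_mono (Set.Iic_subset_Iic.2 hst)
  obtain ⟨a, ha⟩ := (hbot.eventually_lt_const hu0).exists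
  obtain ⟨c, hc⟩ := (htop.eventually_const_lt hu1).exists
  obtain ⟨t, ht⟩ := mem_range_of_exists_le_of_exists_ge hcont ⟨a, ha.le⟩ ⟨c, hc.le⟩
  have hbdd : BddBelow {t | u ≤ ν.real (Set.Iic t)} :=
    ⟨a, fun s hs => le_of_lt (hmono.reflect_lt (ha.trans_le hs))⟩
  have hclosed : IsClosed {t | u ≤ ν.real (Set.Iic t)} := isClosed_le continuous_const hcont
  exact le_antisymm ((hmono (csInf_le hbdd ht.ge)).trans_eq ht)
    (hclosed.csInf_mem ⟨t, ht.ge⟩ hbdd)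

open scoped MatrixOrder in
/-- The Mahalanobis norm of a nondegenerate centered normal vector has the `χ²` law. -/
lemma map_quadraticForm_multivariateGaussian {d : ℕ} {S : Matrix (Fin d) (Fin d) ℝ}
    (hS : S.PosSemidef) (hdet : S.det ≠ 0) :
    (multivariateGaussian 0 S).map (fun x : EuclideanSpace ℝ (Fin d) => x ⬝ᵥ (S⁻¹ *ᵥ x))
      = chiSq d := by
  have hm : Measurable fun x : EuclideanSpace ℝ (Fin d) => x ⬝ᵥ (S⁻¹ *ᵥ x) := by
    unfold dotProduct Matrix.mulVec dotProduct
    fun_prop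
  rw [multivariateGaussian, ← map_pi_eq_stdGaussian, Measure.map_map hm (by fun_prop),
    Measure.map_map (hm.comp (by fun_prop)) (by fun_prop), chiSq]
  congr 1
  ext z
  -- The normal vector is R z with z standard and R symmetric, so the form is zᵀ R (R R)⁻¹ R z = zᵀ
  -- z.
  set R := CFC.sqrt S with hR
  have hRR : R * R = S := by
    exact CFC.sqrt_mul_sqrt_self S (Matrix.nonneg_iff_posSemidef.2 hS)
  have hRt : Rᵀ = R := by
    have : R.PosSemidef := by
      exact Matrix.nonneg_iff_posSemidef.1 (CFC.sqrt_nonneg S)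
    exact this.isHermitian
  have hRdet : R.det ≠ 0 := fun h0 => hdet (by rw [← hRR, Matrix.det_mul, h0, zero_mul])
  have hu : IsUnit R.det := isUnit_iff_ne_zero.2 hRdet
  have hz : ((0 : EuclideanSpace ℝ (Fin d)) + Matrix.toEuclideanCLM (𝕜 := ℝ) R
      (WithLp.toLp 2 z)).ofLp = R *ᵥ z := by
    simp
  simp only [Function.comp_apply]
  rw [hz, ← hRR, Matrix.mul_inv_rev, Matrix.mulVec_mulVec, Matrix.mul_assoc,
    Matrix.nonsing_inv_mul _ hu, Matrix.mul_one, Matrix.dotProduct_mulVec, ← Matrix.mulVec_transpose,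
    Matrix.transpose_nonsing_inv, hRt, Matrix.mulVec_mulVec, Matrix.nonsing_inv_mul _ hu,
    Matrix.one_mulVec]
  simp [dotProduct, sq]

end ChiSq

/-! ### Measurability of the estimators -/

section Measurability

variable {Ω : Type*} [MeasurableSpace Ω] {d : ℕ}

lemma measurable_det_of_entries {A : Ω → Matrix (Fin d) (Fin d) ℝ}
    (hA : ∀ i j, Measurable fun ω => A ω i j) : Measurable fun ω => (A ω).det := by
  simp_rw [Matrix.det_apply']
  exact Finset.measurable_sum _ fun σ _ =>
    (Finset.measurable_prod _ fun i _ => hA _ _).const_mul _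

/-- Cramer's formula expresses the entries through determinants. The scalar inverse is measurable
also at zero, so singular matrices need no exclusion. -/
lemma measurable_inv_entries {A : Ω → Matrix (Fin d) (Fin d) ℝ}
    (hA : ∀ i j, Measurable fun ω => A ω i j) (i j : Fin d) :
    Measurable fun ω => (A ω)⁻¹ i j := by
  simp_rw [Matrix.inv_def, Ring.inverse_eq_inv', Matrix.smul_apply, smul_eq_mul,
    Matrix.adjugate_apply]
  refine (measurable_det_of_entries hA).inv.mul (measurable_det_of_entries fun r c => ?_)
  simp_rw [Matrix.updateRow_apply]
  split_ifs
  · exact measurable_const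
  · exact hA r c

lemma measurable_mul_entries {A B : Ω → Matrix (Fin d) (Fin d) ℝ}
    (hA : ∀ i j, Measurable fun ω => A ω i j) (hB : ∀ i j, Measurable fun ω => B ω i j)
    (i j : Fin d) : Measurable fun ω => (A ω * B ω) i j := by
  simp_rw [Matrix.mul_apply]
  exact Finset.measurable_sum _ fun r _ => (hA i r).mul (hB r j)

variable {M : ℕ} {p : ℕ → Fin M → ℝ} {X : ℕ → Ω → Fin d → ℝ} {Y : ℕ → Ω → ℝ}

lemma measurable_secondMomentHat (hX : ∀ j, Measurable (X j)) (n : ℕ) (m : Fin M) (i s : Fin d) :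
    Measurable fun ω => secondMomentHat p (fun j => X j ω) n m i s := by
  have hXe : ∀ j i, Measurable fun ω => X j ω i := fun j i => (measurable_pi_apply i).comp (hX j)
  simp only [secondMomentHat, Matrix.of_apply]
  fun_prop

lemma measurable_lsEstimator (hX : ∀ j, Measurable (X j)) (hY : ∀ j, Measurable (Y j))
    (m : Fin M) (n : ℕ) (i : Fin d) :
    Measurable fun ω => lsEstimator p (fun j => X j ω) (fun j => Y j ω) m n i := by
  have hXe : ∀ j i, Measurable fun ω => X j ω i := fun j i => (measurable_pi_apply i).comp (hX j)
  simp only [lsEstimator, Matrix.mulVec, dotProduct]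
  refine Finset.measurable_sum _ fun r _ => Measurable.mul (measurable_inv_entries ?_ i r) ?_
  · intro a c
    simp only [Matrix.mul_apply, Matrix.transpose_apply, Matrix.of_apply]
    fun_prop
  · simp only [Matrix.mul_diagonal, Matrix.transpose_apply, Matrix.of_apply]
    fun_prop

lemma measurable_dispersionHat (hX : ∀ j, Measurable (X j)) (hY : ∀ j, Measurable (Y j))
    (k : Fin M) (n : ℕ) (i l : Fin d) :
    Measurable fun ω => dispersionHat p (fun j => X j ω) (fun j => Y j ω) k n i l := by
  have hXe : ∀ j i, Measurable fun ω => X j ω i := fun j i => (measurable_pi_apply i).comp (hX j)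
  have hD := fun m i s => measurable_secondMomentHat (p := p) hX n m i s
  have hb := fun m i => measurable_lsEstimator (p := p) hX hY m n i
  have hL : ∀ m i s l q, Measurable fun ω =>
      fourthMomentHat p (fun j => X j ω) n m i s l q := fun m i s l q => by
    simp only [fourthMomentHat, Matrix.of_apply]
    fun_prop
  have hσ : ∀ m, Measurable fun ω =>
      errorVarHat p (fun j => X j ω) (fun j => Y j ω) n m := fun m => by
    simp only [errorVarHat, dotProduct]
    fun_prop
  have hDi := fun i j => measurable_inv_entries (hD k) i j
  simp only [dispersionHat, dispersion]
  refine measurable_mul_entries (measurable_mul_entries hDi fun i l => ?_) hDi i l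
  simp only [sigmaMatrix_apply, dotProduct, Matrix.mulVec, Pi.sub_apply]
  fun_prop

end Measurability

/-! ### The asymptotic level of the confidence set -/

/-- The two factors 1/√n absorb n, and the symmetry of D̂ moves its inverse across the dot product.
-/
lemma statS_eq {M d : ℕ} {p : ℕ → Fin M → ℝ} {x : ℕ → Fin d → ℝ} {y : ℕ → ℝ} {k : Fin M} {n : ℕ}
    (hn : n ≠ 0) (hdet : (secondMomentHat p x n k).det ≠ 0) (β : Fin d → ℝ) :
    statS p x y k n β = scoreSum p x y k β n ⬝ᵥ (((secondMomentHat p x n k)⁻¹ *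
      (dispersionHat p x y k n)⁻¹ * (secondMomentHat p x n k)⁻¹) *ᵥ scoreSum p x y k β n) := by
  set D := secondMomentHat p x n k with hD
  set V := dispersionHat p x y k n
  set u := scoreSum p x y k β n with hu
  have hn0 : (0 : ℝ) ≤ n := n.cast_nonneg
  have hsq : (√(n : ℝ))⁻¹ * (√(n : ℝ))⁻¹ = 1 / n := by
    rw [← mul_inv, Real.mul_self_sqrt hn0, one_div]
  have hsub : lsEstimator p x y k n - β = (√(n : ℝ))⁻¹ • (D⁻¹ *ᵥ u) := by
    rw [lsEstimator_sub_eq hn hdet, ← Matrix.mulVec_smul]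
    congr 1
    ext i
    rw [Pi.smul_apply, smul_eq_mul, hu, scoreSum, ← mul_assoc, hsq]
  have hneg : β - lsEstimator p x y k n = -((√(n : ℝ))⁻¹ • (D⁻¹ *ᵥ u)) := by
    rw [← hsub, neg_sub]
  have hDt : (D⁻¹)ᵀ = D⁻¹ := by
    rw [Matrix.transpose_nonsing_inv, hD, secondMomentHat_isSymm]
  have hquad : (D⁻¹ *ᵥ u) ⬝ᵥ (V⁻¹ *ᵥ (D⁻¹ *ᵥ u)) = u ⬝ᵥ ((D⁻¹ * V⁻¹ * D⁻¹) *ᵥ u) := by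
    rw [Matrix.mul_assoc, ← Matrix.mulVec_mulVec, ← Matrix.mulVec_mulVec,
      Matrix.dotProduct_mulVec u, ← Matrix.mulVec_transpose, hDt]
  rw [statS, hneg, Matrix.mulVec_neg, neg_dotProduct_neg, Matrix.mulVec_smul, smul_dotProduct,
    dotProduct_smul, smul_smul, hsq, smul_eq_mul, hquad, ← mul_assoc,
    mul_one_div_cancel (Nat.cast_ne_zero.2 hn), one_mul]

/-- The sandwich in V cancels against the outer factors, so the statistic is normalized by Σ⁻¹ in
the limit. -/
lemma inv_mul_dispersion_inv_mul_inv {d : ℕ} {D S : Matrix (Fin d) (Fin d) ℝ} (hD : D.det ≠ 0) :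
    D⁻¹ * (D⁻¹ * S * D⁻¹)⁻¹ * D⁻¹ = S⁻¹ := by
  have hu : IsUnit D.det := isUnit_iff_ne_zero.2 hD
  rw [Matrix.mul_inv_rev, Matrix.mul_inv_rev, Matrix.nonsing_inv_nonsing_inv _ hu,
    Matrix.mul_assoc, Matrix.mul_assoc, Matrix.mul_assoc, Matrix.mul_nonsing_inv _ hu,
    Matrix.mul_one, ← Matrix.mul_assoc, Matrix.nonsing_inv_mul _ hu, Matrix.one_mul]

lemma abs_measureReal_sub_le_of_subset_union {Ω : Type*} [MeasurableSpace Ω] {μ : Measure Ω}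
    [IsFiniteMeasure μ] {A B N : Set Ω} (hAB : A ⊆ B ∪ N) (hBA : B ⊆ A ∪ N) :
    |μ.real A - μ.real B| ≤ μ.real N := by
  have h1 := (measureReal_mono hAB (μ := μ)).trans (measureReal_union_le _ _)
  have h2 := (measureReal_mono hBA (μ := μ)).trans (measureReal_union_le _ _)
  rw [abs_le]
  constructor <;> linarith

/-- Slutsky's theorem for the pair of the score sum, convergent in law, and the normalizing matrix,
convergent in probability to Σ⁻¹. -/
theorem IsRegressionMixture.tendstoInDistribution_quadraticForm {M d : ℕ}
    {FX : Fin M → Measure (Fin d → ℝ)} {Fe : Fin M → Measure ℝ}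
    {Ω : Type*} [MeasurableSpace Ω] {μ : Measure Ω} {p : ℕ → Fin M → ℝ} {b : Fin M → Fin d → ℝ}
    {κ : ℕ → Ω → Fin M} {X : ℕ → Ω → Fin d → ℝ} {ε : ℕ → Ω → ℝ} {Y : ℕ → Ω → ℝ}
    [IsProbabilityMeasure μ] [∀ m, IsProbabilityMeasure (FX m)] [∀ m, IsProbabilityMeasure (Fe m)]
    (h : IsRegressionMixture μ p b FX Fe κ X ε Y)
    (hX4 : ∀ m i, Integrable (fun x : Fin d → ℝ => x i ^ 4) (FX m))
    (he4 : ∀ m, Integrable (fun e : ℝ => e ^ 4) (Fe m))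
    (hD : ∀ m, (secondMoment (FX m)).det ≠ 0)
    (hΓ : ∃ C : ℝ, 0 < C ∧ ∀ᶠ n in atTop, C < (gramMatrix p n).det) {k : Fin M}
    {αlim : Fin M → Fin M → ℝ}
    (hαlim : ∀ s q, Tendsto (fun n => alphaHat p k n s q) atTop (𝓝 (αlim s q)))
    (hV : (dispersion k αlim (fun m => secondMoment (FX m)) (fun m => fourthMoment (FX m)) b
      (fun m => variance id (Fe m))).det ≠ 0) :
    TendstoInDistribution (fun n ω =>
      scoreSum p (fun j => X j ω) (fun j => Y j ω) k (b k) n ⬝ᵥ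
        (((secondMomentHat p (fun j => X j ω) n k)⁻¹ *
        (dispersionHat p (fun j => X j ω) (fun j => Y j ω) k n)⁻¹ *
        (secondMomentHat p (fun j => X j ω) n k)⁻¹) *ᵥ
        scoreSum p (fun j => X j ω) (fun j => Y j ω) k (b k) n)) atTop (id : ℝ → ℝ) (fun _ => μ)
      (chiSq d) := by
  set S := sigmaMatrix k αlim (fun m => secondMoment (FX m))
        (fun m => fourthMoment (FX m)) b (fun m => variance id (Fe m)) with hS
  -- Σ is a factor of V, so V would be singular along with it.
  have hSdet : S.det ≠ 0 := fun h0 => hV (by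
    rw [dispersion, Matrix.det_mul, Matrix.det_mul, ← hS, h0, mul_zero, zero_mul])
  have hSpsd : S.PosSemidef := h.posSemidef_sigmaMatrix hX4 he4 hαlim
  have hinv := tendsto_matrix_inv (h.tendsto_secondMomentHat hX4 hΓ k) (hD k)
  have hW := (hinv.mul (tendsto_matrix_inv (h.tendsto_dispersionHat hX4 he4 hΓ hD hαlim) hV)).mul
    hinv
  rw [dispersion, inv_mul_dispersion_inv_mul_inv (hD k), ← hS] at hW
  have hg : Continuous fun z : EuclideanSpace ℝ (Fin d) × (Fin d → Fin d → ℝ) =>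
      z.1.ofLp ⬝ᵥ (Matrix.of z.2 *ᵥ z.1.ofLp) := by
    simp only [dotProduct, Matrix.mulVec, Matrix.of_apply]
    fun_prop
  have hDm := fun n i j => measurable_inv_entries
    (measurable_secondMomentHat (p := p) h.measurable_regressors n k) i j
  have hWm : ∀ n i j, Measurable fun ω => ((secondMomentHat p (fun j => X j ω) n k)⁻¹ *
      (dispersionHat p (fun j => X j ω) (fun j => Y j ω) k n)⁻¹ *
      (secondMomentHat p (fun j => X j ω) n k)⁻¹) i j := fun n =>
    measurable_mul_entries (measurable_mul_entries (hDm n) (measurable_inv_entries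
      (measurable_dispersionHat h.measurable_regressors h.measurable_response k n))) (hDm n)
  have hslutsky := (h.tendstoInDistribution_scoreSum hX4 he4 hΓ
    hαlim).continuous_comp_prodMk_of_tendstoInMeasure_const hg
    (Y := fun n ω i j => ((secondMomentHat p (fun j => X j ω) n k)⁻¹ *
      (dispersionHat p (fun j => X j ω) (fun j => Y j ω) k n)⁻¹ *
      (secondMomentHat p (fun j => X j ω) n k)⁻¹) i j) (c := fun i j => S⁻¹ i j)
    (tendsto_probFilter_iff.1 hW)
    (fun n => (measurable_pi_lambda _ fun i => measurable_pi_lambda _ fun j =>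
      hWm n i j).aemeasurable)
  refine ⟨hslutsky.forall_aemeasurable, aemeasurable_id, ?_⟩
  have hlaw : (⟨(chiSq d).map id, Measure.isProbabilityMeasure_map aemeasurable_id⟩ :
      ProbabilityMeasure ℝ) = ⟨_, Measure.isProbabilityMeasure_map hslutsky.aemeasurable_limit⟩ :=
    Subtype.ext (by
      simp only [Measure.map_id]
      exact (map_quadraticForm_multivariateGaussian hSpsd hSdet).symm)
  rw [hlaw]
  exact hslutsky.tendsto

end MixReg

theorem theorem4 {Ω : Type*} [MeasurableSpace Ω] (μ : Measure Ω) [IsProbabilityMeasure μ]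
    {M d : ℕ} (hd : 1 ≤ d)
    (p : ℕ → Fin M → ℝ) (b : Fin M → Fin d → ℝ)
    (FX : Fin M → Measure (Fin d → ℝ)) [∀ m, IsProbabilityMeasure (FX m)]
    (Fe : Fin M → Measure ℝ) [∀ m, IsProbabilityMeasure (Fe m)]
    (κ : ℕ → Ω → Fin M) (X : ℕ → Ω → Fin d → ℝ) (ε : ℕ → Ω → ℝ) (Y : ℕ → Ω → ℝ)
    (hmodel : IsRegressionMixture μ p b FX Fe κ X ε Y)
    (k : Fin M)
    -- finite fourth moments
    (hX4 : ∀ m i, Integrable (fun x : Fin d → ℝ => x i ^ 4) (FX m))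
    (he4 : ∀ m, Integrable (fun e : ℝ => e ^ 4) (Fe m))
    -- nonsingular second moment matrices
    (hD : ∀ m, (secondMoment (FX m)).det ≠ 0)
    -- the Gram determinants are bounded away from zero
    (hΓ : ∃ C : ℝ, 0 < C ∧ ∀ᶠ n in atTop, C < (gramMatrix p n).det)
    -- existence of the limits of the averaged squared weights
    (αlim : Fin M → Fin M → ℝ)
    (hαlim : ∀ s q, Tendsto (fun n => alphaHat p k n s q) atTop (𝓝 (αlim s q)))
    -- nonsingular limiting dispersion matrix
    (hV : (dispersion k αlim (fun m => secondMoment (FX m)) (fun m => fourthMoment (FX m)) b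
      (fun m => variance id (Fe m))).det ≠ 0)
    (α : ℝ) (hα0 : 0 < α) (hα1 : α < 1) :
    Tendsto
      (fun n => μ.real {ω | b k ∉
        confidenceSet p (fun j => X j ω) (fun j => Y j ω) k n α})
      atTop (𝓝 α) := by
  have hchi := nullSingletonClass_chiSq hd
  set q := quantile (chiSq d) (1 - α) with hq
  have hdist := hmodel.tendstoInDistribution_quadraticForm hX4 he4 hD hΓ hαlim hV
  set Q : ℕ → Ω → ℝ := fun n ω => scoreSum p (fun j => X j ω) (fun j => Y j ω) k (b k) n ⬝ᵥ
        (((secondMomentHat p (fun j => X j ω) n k)⁻¹ *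
        (dispersionHat p (fun j => X j ω) (fun j => Y j ω) k n)⁻¹ *
        (secondMomentHat p (fun j => X j ω) n k)⁻¹) *ᵥ
        scoreSum p (fun j => X j ω) (fun j => Y j ω) k (b k) n)
  have htail : (chiSq d).real (Set.Ioi q) = α := by
    rw [← Set.compl_Iic, probReal_compl_eq_one_sub measurableSet_Iic,
      measureReal_Iic_quantile _ (by linarith) (by linarith)]
    ring
  have hQ : Tendsto (fun n => μ.real {ω | q < Q n ω}) atTop (𝓝 α) := by
    -- Portmanteau: the boundary of the half-line is the single point q, which is null for the χ²
    -- law.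
    have h1 := ProbabilityMeasure.tendsto_measure_of_null_frontier_of_tendsto' hdist.tendsto
      (E := Set.Ioi q) (by simp)
    simp only [ProbabilityMeasure.coe_mk, Measure.map_id] at h1
    have h2 := (ENNReal.tendsto_toReal (measure_ne_top _ _)).comp h1
    rw [show ((chiSq d) (Set.Ioi q)).toReal = α from htail] at h2
    refine h2.congr fun n => ?_
    simp only [Function.comp_apply]
    rw [Measure.map_apply_of_aemeasurable (hdist.forall_aemeasurable n) measurableSet_Ioi]
    rfl
  have hgood := hmodel.eventually_det_secondMomentHat_ne_zero hX4 hΓ (hD k)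
  rw [Filter.Eventually, mem_probFilter_iff] at hgood
  have hbad := (ENNReal.tendsto_toReal ENNReal.zero_ne_top).comp hgood
  refine (tendsto_iff_of_dist ?_).1 hQ
  -- Noncoverage and q < Q agree wherever n ≠ 0 and D̂ is nonsingular, so their probabilities differ
  -- by at most that of the complementary event.
  refine squeeze_zero (fun n => dist_nonneg) (fun n => ?_) hbad
  rw [Real.dist_eq]
  have hstat : ∀ ω, (n ≠ 0 ∧ (secondMomentHat p (fun j => X j ω) n k).det ≠ 0) →
      (b k ∉ confidenceSet p (fun j => X j ω) (fun j => Y j ω) k n α ↔ q < Q n ω) := by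
    intro ω hω
    rw [confidenceSet, Set.mem_ofPred_eq, not_le, statS_eq hω.1 hω.2]
  refine abs_measureReal_sub_le_of_subset_union (fun ω hω => ?_) (fun ω hω => ?_)
  · by_cases hg : n ≠ 0 ∧ (secondMomentHat p (fun j => X j ω) n k).det ≠ 0
    · exact Or.inl ((hstat ω hg).2 hω)
    · exact Or.inr hg
  · by_cases hg : n ≠ 0 ∧ (secondMomentHat p (fun j => X j ω) n k).det ≠ 0
    · exact Or.inl ((hstat ω hg).1 hω)
    · exact Or.inr hg
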